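/- Let $\mathcal L_A=\{+,\cdot,<,0,1\}$. A formula of $\mathcal L_A$ is \emph{limited} if all its quantifiers are of the form $\forall x<t$ or $\exists x<t$, with $t$ a term not containing $x$. Let $PA$ be the $\mathcal L_A$-theory with axioms: associativity of $+$ and $\cdot$; $0$ and $1$ are neutral for $+$ and $\cdot$ respectively; distributivity; $<$ is a strict linear order with first element $0$ and no last element, in which every element has an immediate successor and every element other than $0$ an immediate predecessor; $1$ is the immediate successor of $0$; $x<y\to x+z<y+z$; and, for every $\mathcal L_A$-formula $\varphi(x,w)$, the induction axiom $\forall w\,[\varphi(0,w)\wedge\forall x(\varphi(x,w)\to\varphi(x+1,w))\to\forall x\,\varphi(x,w)]$. Let $T$ be the theory in the language $\mathcal L_A\cup\{c_0,c_1,c_2,\dots\}$, with new constants $c_i$, whose axioms are: (i) the recursion equations $x+0=x$, $x+(y+1)=(x+y)+1$, $x\cdot 0=0$, $x\cdot(y+1)=x\cdot y+x$, $\neg\,x<0$, $x<y+1\leftrightarrow(x<y\vee x=y)$, and the induction axioms for limited $\mathcal L_A$-formulas only; (ii) $(c_i)^2<c_{i+1}$ for each $i\in\omega$; (iii) for all $i\in\omega$,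 all increasing tuples $k=(k_1<\dots<k_r)$ and $k'=(k'_1<\dots<k'_r)$ of natural numbers with $i<k_1$ and $i<k'_1$, and every limited $\mathcal L_A$-formula $\psi(y;z)$ with $z=(z_1,\dots,z_r)$ and $y$ a finite tuple of variables, the axiom $\forall y<c_i\,[\psi(y;c(k))\leftrightarrow\psi(y;c(k'))]$, where $c(k)=(c_{k_1},\dots,c_{k_r})$. For an $\mathcal L_A$-formula $\theta(y)$ (with primitives $\bot,=,<,\to,\forall$, and $\exists$ an abbreviation of $\neg\forall\neg$), let $\theta^*(y;z_1,z_2,\dots)$ be the limited formula obtained from $\theta$ by replacing each quantifier $\forall x$ or $\exists x$ that lies in the scope of exactly $d$ other quantifiers by $\forall x<z_{d+1}$ or $\exists x<z_{d+1}$, where the $z_j$ are new variables. Then: (1) $\mathrm{Con}(T)$ implies $\mathrm{Con}(PA)$, where $\mathrm{Con}$ says that no contradiction is derivable in first-order logic with equality. (2) Let $\mathcal U$ be a model of $T$ and let $I$ be the set of all $a\in\mathcal U$ such that $a<c_i$ for some $i\in\omega$. Then $I$ is an initial segment of $\mathcal U$, closed under $+$ and $\cdot$ and containing $0$ and $1$,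 and: (A1) $\mathcal I=(I,+,\cdot,<,0,1)\models PA$. (A2) For every $\mathcal L_A$-formula $\theta(y)$, every $i\in\omega$, every increasing sequence $k=(k_1<k_2<\cdots)$ of natural numbers with $i<k_1$ (only as many terms matter as $\theta^*$ has variables $z_j$), and every tuple $a$ of elements of $I$, of the length of $y$, with all entries $<c_i$, $$\mathcal I\models\theta(a)\iff\mathcal U\models\theta^*(a;c(k)).$$ -/

import Mathlib

open FirstOrder FirstOrder.Language

/-! ### A proof calculus for first-order logic, and consistency -/

namespace FirstOrder.Language

universe u v

variable {L : FirstOrder.Language.{u, v}}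

/-- `inst φ t` is `φ(t)`, where the single de Bruijn variable of `φ` is replaced by `t`. -/
def inst (φ : L.BoundedFormula ℕ 1) (t : L.Term ℕ) : L.Formula ℕ :=
  φ.toFormula.subst (Sum.elim Term.var fun _ => t)

/-- Renames the free variables `0, 1, 2, …` to `1, 2, 3, …`, so that variable `0` becomes fresh. -/
def shift {n : ℕ} (φ : L.BoundedFormula ℕ n) : L.BoundedFormula ℕ n :=
  φ.subst fun m => Term.var (m + 1)

/-- Classical natural deduction with equality; `Derives Γ φ` means `Γ ⊢ φ`. Formulas have free
variables indexed by `ℕ`, and `⊥`, `=`, relations, `→`, `∀` are the primitives of the language. -/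
inductive Derives : Set (L.Formula ℕ) → L.Formula ℕ → Prop
  | hyp {Γ : Set (L.Formula ℕ)} {φ : L.Formula ℕ} : φ ∈ Γ → Derives Γ φ
  | impI {Γ : Set (L.Formula ℕ)} {φ ψ : L.Formula ℕ} :
      Derives (insert φ Γ) ψ → Derives Γ (φ.imp ψ)
  | impE {Γ : Set (L.Formula ℕ)} {φ ψ : L.Formula ℕ} :
      Derives Γ (φ.imp ψ) → Derives Γ φ → Derives Γ ψ
  | byContra {Γ : Set (L.Formula ℕ)} {φ : L.Formula ℕ} :
      Derives (insert φ.not Γ) BoundedFormula.falsum → Derives Γ φ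
  | allI {Γ : Set (L.Formula ℕ)} {φ : L.BoundedFormula ℕ 1} :
      Derives (shift '' Γ) (inst (shift φ) (Term.var 0)) → Derives Γ φ.all
  | allE {Γ : Set (L.Formula ℕ)} {φ : L.BoundedFormula ℕ 1} (t : L.Term ℕ) :
      Derives Γ φ.all → Derives Γ (inst φ t)
  | eqRefl {Γ : Set (L.Formula ℕ)} (t : L.Term ℕ) : Derives Γ (t.equal t)
  | eqSubst {Γ : Set (L.Formula ℕ)} {φ : L.BoundedFormula ℕ 1} {s t : L.Term ℕ} :
      Derives Γ (s.equal t) → Derives Γ (inst φ s) → Derives Γ (inst φ t)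

/-- `Con(T)`: no contradiction is derivable from the sentences of `T`. -/
def Consistent (T : L.Theory) : Prop :=
  ¬ Derives ((fun σ : L.Sentence => Formula.relabel (Empty.elim : Empty → ℕ) σ) '' T)
      BoundedFormula.falsum

end FirstOrder.Language

namespace Arith

/-! ### The language `{+, ·, <, 0, 1}` of arithmetic -/

inductive Func : ℕ → Type
  | zero : Func 0
  | one : Func 0
  | add : Func 2
  | mul : Func 2

inductive Rel : ℕ → Type
  | lt : Rel 2

def arith : FirstOrder.Language.{0, 0} := ⟨Func, Rel⟩

def zeroSym : arith.Constants := Func.zero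
def oneSym : arith.Constants := Func.one
def addSym : arith.Functions 2 := Func.add
def mulSym : arith.Functions 2 := Func.mul
def ltSym : arith.Relations 2 := Rel.lt

instance {α : Type*} : Zero (arith.Term α) := ⟨zeroSym.term⟩
instance {α : Type*} : One (arith.Term α) := ⟨oneSym.term⟩
instance {α : Type*} : Add (arith.Term α) := ⟨addSym.apply₂⟩
instance {α : Type*} : Mul (arith.Term α) := ⟨mulSym.apply₂⟩

/-- The atomic formula `s < t`. -/
def lt {α : Type*} {n : ℕ} (s t : arith.Term (α ⊕ Fin n)) : arith.BoundedFormula α n :=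
  ltSym.boundedFormula₂ s t

/-- The limited (bounded, `Δ₀`) formulas of `arith`: every quantifier has the form `∀ x < t` or
`∃ x < t`, where `t` is a term in which `x` does not occur. -/
inductive IsLimited {α : Type*} : ∀ {n : ℕ}, arith.BoundedFormula α n → Prop
  | falsum {n : ℕ} : IsLimited (BoundedFormula.falsum : arith.BoundedFormula α n)
  | equal {n : ℕ} (s t : arith.Term (α ⊕ Fin n)) : IsLimited (BoundedFormula.equal s t)
  | rel {n l : ℕ} (R : arith.Relations l) (ts : Fin l → arith.Term (α ⊕ Fin n)) :
      IsLimited (BoundedFormula.rel R ts)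
  | imp {n : ℕ} {φ ψ : arith.BoundedFormula α n} :
      IsLimited φ → IsLimited ψ → IsLimited (φ.imp ψ)
  | all_lt {n : ℕ} (t : arith.Term (α ⊕ Fin n)) {φ : arith.BoundedFormula α (n + 1)} :
      IsLimited φ → IsLimited
        (∀' (lt (&(Fin.last n)) (t.relabel (Sum.map id Fin.castSucc)) ⟹ φ))
  | ex_lt {n : ℕ} (t : arith.Term (α ⊕ Fin n)) {φ : arith.BoundedFormula α (n + 1)} :
      IsLimited φ → IsLimited
        (∃' (lt (&(Fin.last n)) (t.relabel (Sum.map id Fin.castSucc)) ⊓ φ))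

/-! ### Peano arithmetic -/

/-- `φ(w, t)`, for a formula `φ(w, x)`. -/
def substX {n : ℕ} {β : Type*} (φ : arith.Formula (Fin n ⊕ Fin 1))
    (w : Fin n → arith.Term β) (t : arith.Term β) : arith.Formula β :=
  BoundedFormula.subst φ (Sum.elim w fun _ => t)

/-- The induction axiom `∀ w [φ(w, 0) ∧ ∀ x (φ(w, x) → φ(w, x + 1)) → ∀ x φ(w, x)]`. -/
noncomputable def inductionAxiom {n : ℕ} (φ : arith.Formula (Fin n ⊕ Fin 1)) : arith.Sentence :=
  let zeroCase : arith.Formula (Fin n) := substX φ Term.var 0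
  let step : arith.Formula (Fin n) := Formula.iAlls (Fin 1)
    (φ ⟹ substX φ (fun j => Term.var (Sum.inl j)) (Term.var (Sum.inr 0) + 1))
  let conclusion : arith.Formula (Fin n) := Formula.iAlls (Fin 1) φ
  Formula.iAlls (Fin n) (Formula.relabel Sum.inr (zeroCase ⊓ step ⟹ conclusion))

/-- The axioms of Peano arithmetic other than induction: associativity, neutral elements,
distributivity, discrete linear order with first element `0` and no last element, `1` is the
successor of `0`, and compatibility of `<` with `+`. -/
def peanoBasic : Set arith.Sentence :=
  { ∀' ∀' ∀' (((&0 + &1) + &2) =' (&0 + (&1 + &2))),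
    ∀' ∀' ∀' (((&0 * &1) * &2) =' (&0 * (&1 * &2))),
    ∀' (((&0 + 0) =' &0) ⊓ ((0 + &0) =' &0)),
    ∀' (((&0 * 1) =' &0) ⊓ ((1 * &0) =' &0)),
    ∀' ∀' ∀' ((&0 * (&1 + &2)) =' (&0 * &1 + &0 * &2)),
    ∀' ∀' ∀' (((&0 + &1) * &2) =' (&0 * &2 + &1 * &2)),
    -- `<` is a strict linear order
    ∀' ∼(lt (&0) (&0)),
    ∀' ∀' ∀' (lt (&0) (&1) ⊓ lt (&1) (&2) ⟹ lt (&0) (&2)),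
    ∀' ∀' (lt (&0) (&1) ⊔ ((&0 =' &1) ⊔ lt (&1) (&0))),
    -- `0` is the first element, and there is no last element
    ∀' ((&0 =' 0) ⊔ lt 0 (&0)),
    ∀' ∃' (lt (&0) (&1)),
    -- immediate successors and, except for `0`, immediate predecessors
    ∀' ∃' (lt (&0) (&1) ⊓ ∀' ∼(lt (&0) (&2) ⊓ lt (&2) (&1))),
    ∀' (∼(&0 =' 0) ⟹ ∃' (lt (&1) (&0) ⊓ ∀' ∼(lt (&1) (&2) ⊓ lt (&2) (&0)))),
    -- `1` is the immediate successor of `0`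
    lt 0 1 ⊓ ∀' ∼(lt 0 (&0) ⊓ lt (&0) 1),
    ∀' ∀' ∀' (lt (&0) (&1) ⟹ lt (&0 + &2) (&1 + &2)) }

/-- Peano arithmetic: the basic axioms and induction for all formulas of `arith`. -/
def peano : arith.Theory :=
  peanoBasic ∪ {σ | ∃ (n : ℕ) (φ : arith.Formula (Fin n ⊕ Fin 1)), σ = inductionAxiom φ}

/-! ### The theory `T`, in the language `arith[[ℕ]]` with new constants `c₀, c₁, …`

`c_i` is `arith.con i`. For a formula `φ` of `arith` with free variables indexed by `ℕ`,
`Formula.equivSentence φ` is the sentence of `arith[[ℕ]]` in which every free variable `i` is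
replaced by the constant `c_i`. -/

/-- The recursion equations for `+`, `·`, `<`. -/
def recursionAxioms : Set arith.Sentence :=
  { ∀' ((&0 + 0) =' &0),
    ∀' ∀' ((&0 + (&1 + 1)) =' ((&0 + &1) + 1)),
    ∀' ((&0 * 0) =' 0),
    ∀' ∀' ((&0 * (&1 + 1)) =' (&0 * &1 + &0)),
    ∀' ∼(lt (&0) 0),
    ∀' ∀' (lt (&0) (&1 + 1) ⇔ (lt (&0) (&1) ⊔ (&0 =' &1))) }

/-- Induction for limited formulas. -/
def limitedInduction : Set arith.Sentence :=
  {σ | ∃ (n : ℕ) (φ : arith.Formula (Fin n ⊕ Fin 1)), IsLimited φ ∧ σ = inductionAxiom φ}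

/-- The axiom `(c_i)² < c_{i+1}`. -/
def squareAxiom (i : ℕ) : arith[[ℕ]].Sentence :=
  Formula.equivSentence
    (lt (Term.var (Sum.inl i) * Term.var (Sum.inl i)) (Term.var (Sum.inl (i + 1))) :
      arith.Formula ℕ)

/-- The axiom `∀ y < c_i [ψ(y; c(k)) ↔ ψ(y; c(k'))]`. In `ψ` the bound variables `&0, …, &(s-1)`
are `y`, and the free variables, indexed by `Fin r`, are `z`. -/
noncomputable def indiscernibilityAxiom {r s : ℕ} (i : ℕ) (k k' : Fin r → ℕ)
    (ψ : arith.BoundedFormula (Fin r) s) : arith[[ℕ]].Sentence :=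
  Formula.equivSentence <| BoundedFormula.alls <|
    (BoundedFormula.iInf fun j : Fin s => lt (&j) (Term.var (Sum.inl i))) ⟹
      (ψ.subst (fun j => Term.var (k j)) ⇔ ψ.subst (fun j => Term.var (k' j)))

/-- The theory `T`. -/
def theoryT : arith[[ℕ]].Theory :=
  (arith.lhomWithConstants ℕ).onTheory (recursionAxioms ∪ limitedInduction) ∪
  Set.range squareAxiom ∪
  {σ | ∃ (r s i : ℕ) (k k' : Fin r → ℕ) (ψ : arith.BoundedFormula (Fin r) s),
    StrictMono k ∧ StrictMono k' ∧ (∀ j, i < k j) ∧ (∀ j, i < k' j) ∧ IsLimited ψ ∧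
    σ = indiscernibilityAxiom i k k' ψ}

/-! ### The bounded translation and the initial segment -/

/-- The bounded translation `θ*(y; z₀, z₁, …)`, for `d = 0`: every quantifier of `θ` that lies in
the scope of exactly `d` other quantifiers is bounded by the new variable `z_d = Sum.inr d`. As
`∃ x` stands for `¬ ∀ x ¬`, it becomes `∃ x < z_d`. In particular, for `θ` in prenex form,
`Q₀ x₀ Q₁ x₁ …` becomes `Q₀ x₀ < z₀ Q₁ x₁ < z₁ …`. -/
def boundedTranslation {α : Type*} : ∀ {n : ℕ}, ℕ → arith.BoundedFormula α n →
    arith.BoundedFormula (α ⊕ ℕ) n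
  | _, _, .falsum => .falsum
  | _, _, .equal s t =>
      .equal (s.relabel (Sum.map Sum.inl id)) (t.relabel (Sum.map Sum.inl id))
  | _, _, .rel R ts => .rel R fun j => (ts j).relabel (Sum.map Sum.inl id)
  | _, d, .imp φ ψ => .imp (boundedTranslation d φ) (boundedTranslation d ψ)
  | n, d, .all φ =>
      .all (lt (&(Fin.last n)) (Term.var (Sum.inl (Sum.inr d))) ⟹ boundedTranslation (d + 1) φ)

section Cut

variable (U : Type*) [arith.Structure U]

/-- The interpretation of `<` in `U`. -/
def ltIn (a b : U) : Prop := Structure.RelMap ltSym ![a, b]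

/-- The interpretation of `+` in `U`. -/
def addIn (a b : U) : U := Structure.funMap addSym ![a, b]

/-- The interpretation of `·` in `U`. -/
def mulIn (a b : U) : U := Structure.funMap mulSym ![a, b]

variable [arith[[ℕ]].Structure U]

/-- The interpretation of the constant `c_i` in `U`. -/
def c (i : ℕ) : U := (arith.con i : arith[[ℕ]].Constants)

/-- The set `I` of the elements of `U` that lie below some `c_i`. -/
def cut : Set U := {a | ∃ i : ℕ, ltIn U a (c U i)}

end Cut

end Arith

/-!
Let `U` be a model of `T` and `I` the cut of the elements below some `c_i`.

The recursion equations and limited induction make `U` a discretely ordered commutative semiring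
(`Arith.isDiscreteOrderedSemiring`), so `c_i² < c_{i+1}` makes the `c_i` increasing, with `2 ≤ c_2`,
and the cut closed under `+` and `·` (`Arith.exists_bound_of_sq_lt`). Its basic laws are inherited
from `U`.

Truth in the cut is computed in `U` by the bounded translation
(`Arith.IsIndiscernibleModel.realize_iff`), by induction on the formula. Only `∀ x θ` with parameters
below `c_i` needs an argument. If it holds in the cut, then `θ*` holds for all `x < c_{k_d}`, since
such `x` are in the cut. Conversely, if `θ*` holds for all `x < c_{k_d}`, and `x` is any element of the
cut, then by indiscernibility `k` may be replaced by a sequence with `x < c_{k_d}`, and the induction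
hypothesis applies to that sequence. The quantifier depth `d` is carried along, because one level
deeper the parameters are bounded by `c_{k_d}` only, and `k_{d+1}` is the first index above it.

Full induction in the cut follows (`Arith.IsIndiscernibleModel.models_inductionAxiom_cut`): for
parameters and `x` below `c_i`, a formula `φ` is equivalent to a limited formula in `U` on the
elements below `c_i`, where limited induction applies. Hence the cut is a model of `PA`.

For the consistency statement, `Con(T)` gives a model of `T` by the completeness theorem
(`FirstOrder.Language.Consistent.exists_model`), the cut of which is a model of `PA`, and soundness
of the calculus gives `Con(PA)`. Completeness is proved by Henkin's construction for a countable
language. The variables themselves serve as witnesses: a theory consists of sentences, so all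
variables are fresh for it, and after finitely many additions cofinitely many still are. The syntactic
identities that this needs reduce to identities between terms by expressing every substitution
through a single operation, `FirstOrder.Language.BoundedFormula.sub`.
-/

namespace FirstOrder.Language

universe u v

variable {L : FirstOrder.Language.{u, v}}

/-! ### Simultaneous substitution -/

namespace Term

theorem subst_subst {α β γ : Type*} (t : L.Term α) (f : α → L.Term β) (g : β → L.Term γ) :
    (t.subst f).subst g = t.subst fun a => (f a).subst g := by
  induction t with
  | var => rfl
  | func f ts ih => simp [ih]

theorem subst_relabel {α β γ : Type*} (t : L.Term α) (f : α → β) (g : β → L.Term γ) :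
    (t.relabel f).subst g = t.subst fun a => g (f a) := by
  induction t with
  | var => rfl
  | func f ts ih => simp [ih]

theorem relabel_eq_subst {α β : Type*} (t : L.Term α) (f : α → β) :
    t.relabel f = t.subst fun a => var (f a) := by
  induction t with
  | var => rfl
  | func f ts ih => simp [ih]

theorem subst_var {α : Type*} (t : L.Term α) : t.subst var = t := by
  induction t with
  | var => rfl
  | func f ts ih => simp [ih]

end Term

/-- A substitution of terms for the free and the bound variables, extended to one more bound
variable, which is kept. -/
def liftSub {α β : Type*} {n m : ℕ} (σ : α ⊕ Fin n → L.Term (β ⊕ Fin m)) :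
    α ⊕ Fin (n + 1) → L.Term (β ⊕ Fin (m + 1)) :=
  Sum.elim (fun a => (σ (Sum.inl a)).relabel (Sum.map id Fin.castSucc))
    (Fin.lastCases (Term.var (Sum.inr (Fin.last m)))
      fun i => (σ (Sum.inr i)).relabel (Sum.map id Fin.castSucc))

section liftSub

variable {α β : Type*} {n m : ℕ} (σ : α ⊕ Fin n → L.Term (β ⊕ Fin m))

@[simp] theorem liftSub_inl (a : α) :
    liftSub σ (Sum.inl a) = (σ (Sum.inl a)).relabel (Sum.map id Fin.castSucc) := rfl

@[simp] theorem liftSub_last :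
    liftSub σ (Sum.inr (Fin.last n)) = Term.var (Sum.inr (Fin.last m)) := by
  simp [liftSub]

@[simp] theorem liftSub_castSucc (i : Fin n) :
    liftSub σ (Sum.inr i.castSucc) = (σ (Sum.inr i)).relabel (Sum.map id Fin.castSucc) := by
  simp [liftSub]

theorem liftSub_ext {σ : α ⊕ Fin n → L.Term (β ⊕ Fin m)}
    {τ : α ⊕ Fin (n + 1) → L.Term (β ⊕ Fin (m + 1))}
    (h₁ : ∀ a, τ (Sum.inl a) = (σ (Sum.inl a)).relabel (Sum.map id Fin.castSucc))
    (h₂ : ∀ i : Fin n, τ (Sum.inr i.castSucc) =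
      (σ (Sum.inr i)).relabel (Sum.map id Fin.castSucc))
    (h₃ : τ (Sum.inr (Fin.last n)) = Term.var (Sum.inr (Fin.last m))) : τ = liftSub σ := by
  funext x
  rcases x with a | i
  · simp [h₁]
  · induction i using Fin.lastCases with
    | last => simp [h₃]
    | cast i => simp [h₂]

end liftSub

namespace BoundedFormula

/-- Capture-avoiding simultaneous substitution of terms for the free variables and for the bound
variables in scope. Substitution, relabelling and the passage to `toFormula` are all special
cases, so that identities between their composites reduce to identities between terms. -/
def sub {α β : Type*} : ∀ {n m : ℕ}, (α ⊕ Fin n → L.Term (β ⊕ Fin m)) → L.BoundedFormula α n →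
    L.BoundedFormula β m
  | _, _, _, .falsum => .falsum
  | _, _, σ, .equal s t => .equal (s.subst σ) (t.subst σ)
  | _, _, σ, .rel R ts => .rel R fun i => (ts i).subst σ
  | _, _, σ, .imp φ ψ => .imp (sub σ φ) (sub σ ψ)
  | _, _, σ, .all φ => .all (sub (liftSub σ) φ)

theorem sub_sub {α β γ : Type*} {n m l : ℕ} (φ : L.BoundedFormula α n)
    (σ : α ⊕ Fin n → L.Term (β ⊕ Fin m)) (τ : β ⊕ Fin m → L.Term (γ ⊕ Fin l)) :
    sub τ (sub σ φ) = sub (fun x => (σ x).subst τ) φ := by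
  induction φ generalizing m l with
  | falsum => rfl
  | equal s t => simp [sub, Term.subst_subst]
  | rel R ts => simp [sub, Term.subst_subst]
  | imp φ ψ ih₁ ih₂ => simp [sub, ih₁, ih₂]
  | all φ ih =>
    simp only [sub, ih]
    congr 2
    have key : ∀ t : L.Term (β ⊕ Fin m), (t.relabel (Sum.map id Fin.castSucc)).subst (liftSub τ) =
        (t.subst τ).relabel (Sum.map id Fin.castSucc) := by
      intro t
      rw [Term.subst_relabel, Term.relabel_eq_subst, Term.subst_subst]
      congr 1
      funext x
      rw [← Term.relabel_eq_subst]
      rcases x with a | i <;> simp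
    apply liftSub_ext <;> simp [key]

theorem subst_eq_sub {α β : Type*} {n : ℕ} (φ : L.BoundedFormula α n) (f : α → L.Term β) :
    φ.subst f = sub (Sum.elim (fun a => (f a).relabel Sum.inl) fun i => Term.var (Sum.inr i)) φ := by
  induction φ with
  | falsum => rfl
  | equal s t => rfl
  | rel R ts => rfl
  | imp φ ψ ih₁ ih₂ => simp only [sub, ← ih₁, ← ih₂]; rfl
  | all φ ih =>
    have : φ.all.subst f = (φ.subst f).all := rfl
    rw [this, ih, sub]
    congr 2
    apply liftSub_ext <;> simp [Function.comp_def]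

theorem relabel_eq_sub {α β : Type*} {n k : ℕ} (φ : L.BoundedFormula α k) (g : α → β ⊕ Fin n) :
    φ.relabel g = sub (fun x => Term.var (relabelAux g k x)) φ := by
  induction φ with
  | falsum => rfl
  | equal s t => simp [relabel, mapTermRel, sub, Term.relabel_eq_subst]
  | rel R ts => simp [relabel, mapTermRel, sub, Term.relabel_eq_subst]
  | imp φ ψ ih₁ ih₂ => simp [sub, ih₁, ih₂]
  | all φ ih =>
    rw [relabel_all, ih, sub]
    congr 2
    apply liftSub_ext
    · intro a
      rcases h : g a with b | i
      · simp [relabelAux, h]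
      · simp [relabelAux, h, Fin.ext_iff]
    · intro i
      simp [relabelAux]
    · simp [relabelAux]

theorem toFormula_eq_sub {α : Type*} {n : ℕ} (φ : L.BoundedFormula α n) :
    φ.toFormula = sub (fun x => Term.var (Sum.inl x)) φ := by
  induction φ with
  | falsum => rfl
  | equal s t => simp [Term.equal, sub, Term.relabel_eq_subst, Term.bdEqual]
  | rel R ts => simp [sub, Term.relabel_eq_subst, Relations.formula, Relations.boundedFormula]
  | imp φ ψ ih₁ ih₂ => simp [sub, ih₁, ih₂]
  | all φ ih =>
    rw [toFormula, ih, relabel_eq_sub, sub_sub, sub]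
    congr 2
    apply liftSub_ext
    · intro a
      simp [relabelAux]
    · intro i
      simp [relabelAux]
    · simp [relabelAux]
      rfl

theorem sub_var {α : Type*} {n : ℕ} (φ : L.BoundedFormula α n) : sub Term.var φ = φ := by
  induction φ with
  | falsum => rfl
  | equal s t => simp [sub, Term.subst_var]
  | rel R ts => simp [sub, Term.subst_var]
  | imp φ ψ ih₁ ih₂ => simp [sub, ih₁, ih₂]
  | all φ ih =>
    rw [sub, ← liftSub_ext (τ := Term.var), ih] <;> simp

theorem realize_sub {M : Type*} [L.Structure M] {α β : Type*} {n m : ℕ} (φ : L.BoundedFormula α n)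
    (σ : α ⊕ Fin n → L.Term (β ⊕ Fin m)) (v : β → M) (xs : Fin m → M) :
    (sub σ φ).Realize v xs ↔ φ.Realize (fun a => (σ (Sum.inl a)).realize (Sum.elim v xs))
      fun i => (σ (Sum.inr i)).realize (Sum.elim v xs) := by
  have key : ∀ {n m : ℕ} (σ : α ⊕ Fin n → L.Term (β ⊕ Fin m)) (xs : Fin m → M),
      (fun x => (σ x).realize (Sum.elim v xs)) =
      Sum.elim (fun a => (σ (Sum.inl a)).realize (Sum.elim v xs))
        fun i => (σ (Sum.inr i)).realize (Sum.elim v xs) := by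
    intro n m σ xs
    funext x
    rcases x with a | i <;> rfl
  induction φ generalizing m with
  | falsum => rfl
  | equal s t => simp [sub, Realize, key]
  | rel R ts => simp [sub, Realize, key]
  | imp φ ψ ih₁ ih₂ => simp [sub, ih₁, ih₂]
  | all φ ih =>
    simp only [sub, realize_all, ih]
    have hx : ∀ a : M, Sum.elim v (Fin.snoc xs a : Fin (m + 1) → M) ∘ Sum.map id Fin.castSucc =
        Sum.elim v xs := by
      intro a
      funext x
      rcases x with b | i <;> simp
    refine forall_congr' fun a => ?_
    simp only [liftSub_inl, Term.realize_relabel, hx]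
    suffices (fun i => (liftSub σ (Sum.inr i)).realize (Sum.elim v (Fin.snoc xs a : Fin (m + 1) → M)))
        = Fin.snoc (fun i => (σ (Sum.inr i)).realize (Sum.elim v xs)) a by rw [this]
    funext i
    induction i using Fin.lastCases with
    | last => simp
    | cast i => simp [hx]

end BoundedFormula

/-! ### Soundness and admissible rules of the calculus -/

theorem BoundedFormula.subst_subst {α β γ : Type*} {n : ℕ} (φ : L.BoundedFormula α n)
    (f : α → L.Term β) (g : β → L.Term γ) :
    (φ.subst f).subst g = φ.subst fun a => (f a).subst g := by
  simp only [BoundedFormula.subst_eq_sub, BoundedFormula.sub_sub]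
  congr 1
  funext x
  rcases x with a | i
  · simp [Term.relabel_eq_subst, Term.subst_subst]
  · simp

/-- `instAll φ xs` is `φ(xs)`, where every bound variable in scope is replaced by a term. -/
def instAll {n : ℕ} (φ : L.BoundedFormula ℕ n) (xs : Fin n → L.Term ℕ) : L.Formula ℕ :=
  BoundedFormula.sub
    (Sum.elim (fun a => Term.var (Sum.inl a)) fun i => (xs i).relabel Sum.inl) φ

theorem inst_eq_instAll (φ : L.BoundedFormula ℕ 1) (t : L.Term ℕ) :
    inst φ t = instAll φ fun _ => t := by
  rw [inst, BoundedFormula.toFormula_eq_sub, BoundedFormula.subst_eq_sub, BoundedFormula.sub_sub,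
    instAll]
  congr 1
  funext x
  rcases x with a | i <;> simp

theorem inst_subst (φ : L.BoundedFormula ℕ 1) (t : L.Term ℕ) (f : ℕ → L.Term ℕ) :
    (inst φ t).subst f = inst (φ.subst f) (t.subst f) := by
  simp only [inst_eq_instAll, instAll, BoundedFormula.subst_eq_sub, BoundedFormula.sub_sub]
  congr 1
  funext x
  rcases x with a | i
  · simp [Term.relabel_eq_subst, Term.subst_subst]
  · simp [Term.relabel_eq_subst, Term.subst_subst]

theorem instAll_all {n : ℕ} (φ : L.BoundedFormula ℕ (n + 1)) (xs : Fin n → L.Term ℕ) :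
    ∃ ψ : L.BoundedFormula ℕ 1, instAll φ.all xs = ψ.all ∧
      ∀ t, inst ψ t = instAll φ (Fin.snoc xs t) := by
  refine ⟨_, rfl, fun t => ?_⟩
  rw [inst_eq_instAll, instAll, instAll, BoundedFormula.sub_sub]
  congr 1
  funext x
  rcases x with a | i
  · simp
  · induction i using Fin.lastCases with
    | last => simp
    | cast i => simp [Term.relabel_eq_subst, Term.subst_subst]

theorem realize_inst {M : Type*} [L.Structure M] (φ : L.BoundedFormula ℕ 1) (t : L.Term ℕ)
    (v : ℕ → M) : (inst φ t).Realize v ↔ φ.Realize v fun _ => t.realize v := by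
  rw [inst_eq_instAll, instAll, Formula.Realize, BoundedFormula.realize_sub]
  simp

namespace Derives

/-- Soundness of the calculus. -/
theorem sound {Γ : Set (L.Formula ℕ)} {φ : L.Formula ℕ} (h : Derives Γ φ) {M : Type*}
    [L.Structure M] (v : ℕ → M) (hv : ∀ ψ ∈ Γ, ψ.Realize v) : φ.Realize v := by
  induction h generalizing v with
  | hyp h => exact hv _ h
  | impI _ ih =>
    intro hφ
    refine ih v ?_
    rintro ψ (rfl | h)
    exacts [hφ, hv ψ h]
  | impE _ _ ih₁ ih₂ => exact ih₁ v hv (ih₂ v hv)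
  | byContra _ ih =>
    by_contra hφ
    refine ih v ?_
    rintro ψ (rfl | h)
    exacts [hφ, hv ψ h]
  | @allI Γ φ _ ih =>
    intro a
    let w : ℕ → M := fun m => Nat.casesOn m a v
    have hw : ∀ {n : ℕ} (ψ : L.BoundedFormula ℕ n) (xs : Fin n → M),
        (shift ψ).Realize w xs ↔ ψ.Realize v xs := fun ψ xs => BoundedFormula.realize_subst
    have := ih w (by
      rintro _ ⟨ψ, hψ, rfl⟩
      exact (hw ψ _).2 (hv ψ hψ))
    rw [realize_inst, hw] at this
    convert this using 1
    funext i
    fin_cases i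
    rfl
  | allE t _ ih =>
    rw [realize_inst]
    convert ih v hv (t.realize v) using 1
    funext i
    fin_cases i
    rfl
  | eqRefl t => exact Formula.realize_equal.2 rfl
  | eqSubst _ _ ih₁ ih₂ =>
    have h₁ := Formula.realize_equal.1 (ih₁ v hv)
    have h₂ := ih₂ v hv
    rw [realize_inst] at h₂ ⊢
    rwa [← h₁]

theorem mono {Γ Δ : Set (L.Formula ℕ)} {φ : L.Formula ℕ} (h : Derives Γ φ) (hΓ : Γ ⊆ Δ) :
    Derives Δ φ := by
  induction h generalizing Δ with
  | hyp h => exact hyp (hΓ h)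
  | impI _ ih => exact impI (ih (Set.insert_subset_insert hΓ))
  | impE _ _ ih₁ ih₂ => exact impE (ih₁ hΓ) (ih₂ hΓ)
  | byContra _ ih => exact byContra (ih (Set.insert_subset_insert hΓ))
  | allI _ ih => exact allI (ih (Set.image_mono hΓ))
  | allE t _ ih => exact allE t (ih hΓ)
  | eqRefl t => exact eqRefl t
  | eqSubst _ _ ih₁ ih₂ => exact eqSubst (ih₁ hΓ) (ih₂ hΓ)

theorem exfalso {Γ : Set (L.Formula ℕ)} {φ : L.Formula ℕ} (h : Derives Γ BoundedFormula.falsum) :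
    Derives Γ φ :=
  byContra (h.mono (Set.subset_insert _ _))

/-- Derivations are stable under renaming of the free variables. -/
theorem rename {Γ : Set (L.Formula ℕ)} {φ : L.Formula ℕ} (h : Derives Γ φ) (ρ : ℕ → ℕ) :
    Derives ((fun ψ => ψ.subst fun j => Term.var (ρ j)) '' Γ)
      (φ.subst fun j => Term.var (ρ j)) := by
  induction h generalizing ρ with
  | hyp h => exact hyp ⟨_, h, rfl⟩
  | impI _ ih =>
    have := ih ρ
    rw [Set.image_insert_eq] at this
    exact impI this
  | impE _ _ ih₁ ih₂ => exact impE (ih₁ ρ) (ih₂ ρ)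
  | byContra _ ih =>
    have := ih ρ
    rw [Set.image_insert_eq] at this
    exact byContra this
  | @allI Γ φ _ ih =>
    -- The variable `0`, which the rule keeps fresh, has to be kept by the renaming.
    have h := ih fun j => Nat.casesOn j 0 fun j => ρ j + 1
    have hs : ∀ {n : ℕ} (ψ : L.BoundedFormula ℕ n),
        (shift ψ).subst (fun j => (Term.var (Nat.casesOn j 0 fun j => ρ j + 1) : L.Term ℕ)) =
          shift (ψ.subst fun j => Term.var (ρ j)) := by
      intro n ψ
      simp only [shift, BoundedFormula.subst_subst]
      rfl
    rw [inst_subst, hs] at h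
    simp only [Set.image_image, hs] at h
    refine allI (φ := φ.subst _) ?_
    rw [Set.image_image]
    exact h
  | allE t _ ih =>
    rw [inst_subst]
    exact allE _ (ih ρ)
  | eqRefl t =>
    have : (t.equal t).subst (fun j => (Term.var (ρ j) : L.Term ℕ)) =
        (t.subst fun j => Term.var (ρ j)).equal (t.subst fun j => Term.var (ρ j)) := by
      simp [BoundedFormula.subst_eq_sub, Term.equal, Term.bdEqual, BoundedFormula.sub,
        Term.relabel_eq_subst, Term.subst_subst]
    rw [this]
    exact eqRefl _
  | @eqSubst Γ φ s t _ _ ih₁ ih₂ =>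
    have : (s.equal t).subst (fun j => (Term.var (ρ j) : L.Term ℕ)) =
        (s.subst fun j => Term.var (ρ j)).equal (t.subst fun j => Term.var (ρ j)) := by
      simp [BoundedFormula.subst_eq_sub, Term.equal, Term.bdEqual, BoundedFormula.sub,
        Term.relabel_eq_subst, Term.subst_subst]
    have h₁ := ih₁ ρ
    have h₂ := ih₂ ρ
    rw [this] at h₁
    rw [inst_subst] at h₂ ⊢
    exact eqSubst h₁ h₂

end Derives

/-- The variable `m` is fresh for `φ`: substitutions in `φ` do not depend on the term that is
substituted for `m`. -/
def IsFresh {n : ℕ} (m : ℕ) (φ : L.BoundedFormula ℕ n) : Prop :=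
  ∀ f g : ℕ → L.Term ℕ, (∀ j, j ≠ m → f j = g j) → φ.subst f = φ.subst g

theorem eventually_isFresh {n : ℕ} (φ : L.BoundedFormula ℕ n) :
    ∀ᶠ m in Filter.atTop, IsFresh m φ := by
  have ht : ∀ {n : ℕ} (t : L.Term (ℕ ⊕ Fin n)), ∀ᶠ m in Filter.atTop,
      ∀ f g : ℕ ⊕ Fin n → L.Term (ℕ ⊕ Fin n), (∀ x, x ≠ Sum.inl m → f x = g x) →
        t.subst f = t.subst g := by
    intro n t
    induction t with
    | var x =>
      rcases x with a | i
      · filter_upwards [Filter.eventually_ne_atTop a] with m hm f g h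
        exact h _ fun e => hm (Sum.inl.inj e).symm
      · exact Filter.Eventually.of_forall fun m f g h => h _ (by simp)
    | func F ts ih =>
      filter_upwards [Filter.eventually_all.2 ih] with m hm f g h
      simp only [Term.subst]
      congr 1
      funext i
      exact hm i f g h
  have he : ∀ {n m : ℕ} {f g : ℕ → L.Term ℕ}, (∀ j, j ≠ m → f j = g j) →
      ∀ x : ℕ ⊕ Fin n, x ≠ Sum.inl m →
        (Sum.elim (Term.relabel Sum.inl ∘ f) (Term.var ∘ Sum.inr) x : L.Term (ℕ ⊕ Fin n)) =
          Sum.elim (Term.relabel Sum.inl ∘ g) (Term.var ∘ Sum.inr) x := by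
    intro n m f g h x hx
    rcases x with a | i
    · simp [h a fun e => hx (e ▸ rfl)]
    · rfl
  induction φ with
  | falsum => exact Filter.Eventually.of_forall fun m f g h => rfl
  | equal s t =>
    filter_upwards [ht s, ht t] with m h₁ h₂ f g h
    exact congrArg₂ BoundedFormula.equal (h₁ _ _ (he h)) (h₂ _ _ (he h))
  | rel R ts =>
    filter_upwards [Filter.eventually_all.2 fun i => ht (ts i)] with m h₁ f g h
    exact congrArg (BoundedFormula.rel R) (funext fun i => h₁ i _ _ (he h))
  | imp φ ψ ih₁ ih₂ =>
    filter_upwards [ih₁, ih₂] with m h₁ h₂ f g h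
    exact congrArg₂ BoundedFormula.imp (h₁ f g h) (h₂ f g h)
  | all φ ih =>
    filter_upwards [ih] with m h₁ f g h
    exact congrArg BoundedFormula.all (h₁ f g h)

/-- Generalization over a fresh named variable, obtained from the rule `allI` by the renaming
that moves `m` to `0` and every other variable up by one. -/
theorem Derives.all_of_fresh {Γ : Set (L.Formula ℕ)} {φ : L.BoundedFormula ℕ 1} {m : ℕ}
    (h : Derives Γ (inst φ (Term.var m))) (hφ : IsFresh m φ) (hΓ : ∀ ψ ∈ Γ, IsFresh m ψ) :
    Derives Γ φ.all := by
  have h' := h.rename fun j => if j = m then 0 else j + 1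
  have hs : ∀ {n : ℕ} {ψ : L.BoundedFormula ℕ n}, IsFresh m ψ →
      ψ.subst (fun j => (Term.var (if j = m then 0 else j + 1) : L.Term ℕ)) = shift ψ :=
    fun hψ => hψ _ _ fun j hj => by simp [hj]
  rw [inst_subst, hs hφ, Set.image_congr fun ψ hψ => hs (hΓ ψ hψ)] at h'
  refine Derives.allI ?_
  simpa using h'

/-! ### Completeness for countable languages -/

/-- The closure conditions on a set of formulas with variables in `ℕ` under which its term model
satisfies exactly the formulas in the set. -/
structure IsHenkin (H : Set (L.Formula ℕ)) : Prop where
  falsum : BoundedFormula.falsum ∉ H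
  imp (φ ψ : L.Formula ℕ) : φ.imp ψ ∈ H ↔ (φ ∈ H → ψ ∈ H)
  all (φ : L.BoundedFormula ℕ 1) : φ.all ∈ H ↔ ∀ t, inst φ t ∈ H
  refl (t : L.Term ℕ) : t.equal t ∈ H
  subst (φ : L.BoundedFormula ℕ 1) (s t : L.Term ℕ) : s.equal t ∈ H → inst φ s ∈ H → inst φ t ∈ H

theorem instAll_equal {n : ℕ} (s t : L.Term (ℕ ⊕ Fin n)) (xs : Fin n → L.Term ℕ) :
    instAll (.equal s t) xs =
      (s.subst (Sum.elim Term.var xs)).equal (t.subst (Sum.elim Term.var xs)) := by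
  have : ∀ s : L.Term (ℕ ⊕ Fin n), s.subst (Sum.elim (fun a => Term.var (Sum.inl a))
      fun i => (xs i).relabel Sum.inl) =
      ((s.subst (Sum.elim Term.var xs)).relabel Sum.inl : L.Term (ℕ ⊕ Fin 0)) := by
    intro s
    rw [Term.relabel_eq_subst, Term.subst_subst]
    congr 1
    funext x
    rcases x with a | i <;> simp [Term.relabel_eq_subst]
  simp [instAll, BoundedFormula.sub, Term.equal, Term.bdEqual, this]

theorem instAll_rel {n l : ℕ} (R : L.Relations l) (ts : Fin l → L.Term (ℕ ⊕ Fin n))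
    (xs : Fin n → L.Term ℕ) :
    instAll (.rel R ts) xs = R.formula fun i => (ts i).subst (Sum.elim Term.var xs) := by
  simp only [instAll, BoundedFormula.sub, Relations.formula, Relations.boundedFormula]
  congr 1
  funext i
  rw [Term.relabel_eq_subst, Term.subst_subst]
  congr 1
  funext x
  rcases x with a | i <;> simp [Term.relabel_eq_subst]

namespace IsHenkin

variable {H : Set (L.Formula ℕ)} (hH : IsHenkin H)

include hH

/-- Leibniz's law for several places at once, by replacing one term after the other. -/
theorem instAll_congr {n : ℕ} (φ : L.BoundedFormula ℕ n) {xs ys : Fin n → L.Term ℕ}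
    (h : ∀ i, (xs i).equal (ys i) ∈ H) (hφ : instAll φ xs ∈ H) : instAll φ ys ∈ H := by
  suffices ∀ s : Finset (Fin n), instAll φ (s.piecewise ys xs) ∈ H by
    simpa using this Finset.univ
  intro s
  induction s using Finset.induction_on with
  | empty => simpa using hφ
  | insert i s hi ih =>
    set zs := s.piecewise ys xs with hzs
    have hz : zs i = xs i := Finset.piecewise_eq_of_notMem _ _ _ hi
    let ψ : L.BoundedFormula ℕ 1 := BoundedFormula.sub
      (Sum.elim (fun a => Term.var (Sum.inl a))
        fun j => if j = i then Term.var (Sum.inr 0) else (zs j).relabel Sum.inl) φ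
    have hψ : ∀ t, inst ψ t = instAll φ (Function.update zs i t) := by
      intro t
      rw [inst_eq_instAll, instAll, instAll, BoundedFormula.sub_sub]
      congr 1
      funext x
      rcases x with a | j
      · simp
      · by_cases hj : j = i
        · subst hj
          simp
        · simp [hj, Term.relabel_eq_subst, Term.subst_subst]
    rw [Finset.piecewise_insert, ← hzs, ← hψ]
    refine hH.subst ψ _ _ (h i) ?_
    rw [hψ, ← hz, Function.update_eq_self]
    exact ih

theorem symm {s t : L.Term ℕ} (h : s.equal t ∈ H) : t.equal s ∈ H := by
  have := hH.instAll_congr (n := 2) (.equal (&0) (&1)) (xs := ![s, s]) (ys := ![t, s])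
    (by intro i; fin_cases i; exacts [h, hH.refl s])
  simp only [instAll_equal] at this
  exact this (hH.refl s)

theorem trans {s t r : L.Term ℕ} (h : s.equal t ∈ H) (h' : t.equal r ∈ H) : s.equal r ∈ H := by
  have := hH.instAll_congr (n := 2) (.equal (&0) (&1)) (xs := ![s, t]) (ys := ![s, r])
    (by intro i; fin_cases i; exacts [hH.refl s, h'])
  simp only [instAll_equal] at this
  exact this h

/-- Provable equality of terms. -/
def setoid : Setoid (L.Term ℕ) where
  r s t := s.equal t ∈ H
  iseqv := ⟨hH.refl, hH.symm, hH.trans⟩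

/-- The term model of a Henkin set: terms modulo provable equality. -/
def TermModel : Type u := Quotient hH.setoid

/-- The class of a term in the term model. -/
def ofTerm (t : L.Term ℕ) : hH.TermModel := Quotient.mk hH.setoid t

/-- A term representing an element of the term model. -/
noncomputable def out (a : hH.TermModel) : L.Term ℕ := Quotient.out (s := hH.setoid) a

theorem ofTerm_eq_ofTerm {s t : L.Term ℕ} : hH.ofTerm s = hH.ofTerm t ↔ s.equal t ∈ H :=
  Quotient.eq (r := hH.setoid)

theorem ofTerm_surjective : Function.Surjective hH.ofTerm := Quotient.mk_surjective (s := hH.setoid)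

theorem out_equal (t : L.Term ℕ) :
    (hH.out (hH.ofTerm t)).equal t ∈ H :=
  Quotient.mk_out (s := hH.setoid) t

noncomputable instance structureTermModel : L.Structure hH.TermModel where
  funMap f ys := hH.ofTerm (Term.func f fun i => hH.out (ys i))
  RelMap R ys := (R.formula fun i => hH.out (ys i)) ∈ H

theorem func_congr {n : ℕ} (f : L.Functions n) {xs ys : Fin n → L.Term ℕ}
    (h : ∀ i, (xs i).equal (ys i) ∈ H) : (Term.func f xs).equal (Term.func f ys) ∈ H := by
  have := hH.instAll_congr
    (.equal (Term.func f fun i => (xs i).relabel Sum.inl) (Term.func f fun i => (&i))) h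
  simp only [instAll_equal, Term.subst, Term.subst_relabel, Sum.elim_inl, Sum.elim_inr,
    Term.subst_var, Function.comp_apply] at this
  exact this (hH.refl _)

theorem rel_congr {n : ℕ} (R : L.Relations n) {xs ys : Fin n → L.Term ℕ}
    (h : ∀ i, (xs i).equal (ys i) ∈ H) (hR : R.formula xs ∈ H) : R.formula ys ∈ H := by
  have := hH.instAll_congr (.rel R fun i => (&i)) h
  simp only [instAll_rel, Term.subst, Sum.elim_inr, Function.comp_apply] at this
  exact this hR

theorem realize_term {n : ℕ} (t : L.Term (ℕ ⊕ Fin n)) (xs : Fin n → L.Term ℕ) :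
    t.realize (M := hH.TermModel) (Sum.elim (fun j => hH.ofTerm (Term.var j))
      fun i => hH.ofTerm (xs i)) =
        hH.ofTerm (t.subst (Sum.elim Term.var xs)) := by
  induction t with
  | var x => rcases x with a | i <;> rfl
  | func f ts ih =>
    simp only [Term.realize_func, ih, Term.subst]
    exact hH.ofTerm_eq_ofTerm.2 <| hH.func_congr f fun i => hH.out_equal _

/-- The truth lemma for the term model. -/
theorem realize_iff {n : ℕ} (φ : L.BoundedFormula ℕ n) (xs : Fin n → L.Term ℕ) :
    φ.Realize (M := hH.TermModel) (fun j => hH.ofTerm (Term.var j))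
      (fun i => hH.ofTerm (xs i)) ↔ instAll φ xs ∈ H := by
  induction φ with
  | falsum => exact iff_of_false id hH.falsum
  | equal s t =>
    simp only [BoundedFormula.Realize, hH.realize_term, instAll_equal]
    exact hH.ofTerm_eq_ofTerm
  | rel R ts =>
    simp only [BoundedFormula.Realize, hH.realize_term, instAll_rel]
    exact ⟨hH.rel_congr R fun i => hH.out_equal _,
      hH.rel_congr R fun i => hH.symm (hH.out_equal _)⟩
  | imp φ ψ ih₁ ih₂ =>
    rw [BoundedFormula.realize_imp, ih₁, ih₂]
    exact (hH.imp _ _).symm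
  | all φ ih =>
    obtain ⟨ψ, h₁, h₂⟩ := instAll_all φ xs
    rw [BoundedFormula.realize_all, h₁, hH.all]
    simp only [h₂, ← ih]
    have hs : ∀ t : L.Term ℕ, (Fin.snoc (fun i => hH.ofTerm (xs i))
        (hH.ofTerm t) : Fin _ → hH.TermModel) =
        fun i => hH.ofTerm ((Fin.snoc xs t : Fin _ → L.Term ℕ) i) := by
      intro t
      funext i
      induction i using Fin.lastCases with
      | last => simp
      | cast i => simp
    refine ⟨fun h t => ?_, fun h a => ?_⟩
    · rw [← hs]
      exact h _
    · obtain ⟨t, rfl⟩ := hH.ofTerm_surjective a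
      rw [hs]
      exact h t

end IsHenkin

/-- One step of Henkin's construction: a consistent set with cofinitely many fresh variables can be
extended so that it derives `φ`, or refutes `φ` together with an instance when `φ` is universal. -/
theorem exists_extension {Γ : Set (L.Formula ℕ)} (hΓ : ¬ Derives Γ BoundedFormula.falsum)
    (hf : ∀ᶠ m in Filter.atTop, ∀ ψ ∈ Γ, IsFresh m ψ) (φ : L.Formula ℕ) :
    ∃ Δ, Γ ⊆ Δ ∧ ¬ Derives Δ BoundedFormula.falsum ∧
      (∀ᶠ m in Filter.atTop, ∀ ψ ∈ Δ, IsFresh m ψ) ∧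
      (Derives Δ φ ∨ Derives Δ φ.not ∧
        ∀ ψ : L.BoundedFormula ℕ 1, φ = ψ.all → ∃ t, Derives Δ (inst ψ t).not) := by
  have hins : ∀ {Γ : Set (L.Formula ℕ)} (χ : L.Formula ℕ),
      (∀ᶠ m in Filter.atTop, ∀ ψ ∈ Γ, IsFresh m ψ) →
        ∀ᶠ m in Filter.atTop, ∀ ψ ∈ insert χ Γ, IsFresh m ψ := by
    intro Γ χ h
    filter_upwards [h, eventually_isFresh χ] with m h₁ h₂
    rintro ψ (rfl | hψ)
    exacts [h₂, h₁ ψ hψ]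
  by_cases hc : Derives (insert φ.not Γ) BoundedFormula.falsum
  · exact ⟨Γ, subset_rfl, hΓ, hf, Or.inl (.byContra hc)⟩
  by_cases hφ : ∃ ψ : L.BoundedFormula ℕ 1, φ = ψ.all
  · obtain ⟨ψ, rfl⟩ := hφ
    obtain ⟨m, h₁, h₂⟩ := ((hins _ hf).and (eventually_isFresh ψ)).exists
    refine ⟨insert (inst ψ (Term.var m)).not (insert ψ.all.not Γ),
      (Set.subset_insert _ _).trans (Set.subset_insert _ _), fun h => hc ?_,
      hins _ (hins _ hf), Or.inr ⟨.hyp (by simp), fun χ hχ => ⟨Term.var m, ?_⟩⟩⟩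
    · exact .impE (.hyp (Set.mem_insert _ _)) (Derives.all_of_fresh (.byContra h) h₂ h₁)
    · cases hχ
      exact .hyp (Set.mem_insert _ _)
  · exact ⟨insert φ.not Γ, Set.subset_insert _ _, hc, hins _ hf,
      Or.inr ⟨.hyp (Set.mem_insert _ _), fun ψ hψ => absurd ⟨ψ, hψ⟩ hφ⟩⟩

/-- Henkin's construction: an enumeration of all formulas is run through, extending the set at each
step; the formulas derivable at some stage form a Henkin set. -/
theorem exists_isHenkin [Countable (L.Formula ℕ)] {Γ : Set (L.Formula ℕ)}
    (hΓ : ¬ Derives Γ BoundedFormula.falsum)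
    (hf : ∀ᶠ m in Filter.atTop, ∀ ψ ∈ Γ, IsFresh m ψ) : ∃ H, Γ ⊆ H ∧ IsHenkin H := by
  obtain ⟨e, he⟩ := exists_surjective_nat (L.Formula ℕ)
  let S := {Δ : Set (L.Formula ℕ) // ¬ Derives Δ BoundedFormula.falsum ∧
    ∀ᶠ m in Filter.atTop, ∀ ψ ∈ Δ, IsFresh m ψ}
  have hstep : ∀ (n : ℕ) (Δ : S), ∃ Δ' : S, Δ.1 ⊆ Δ'.1 ∧ (Derives Δ'.1 (e n) ∨
      Derives Δ'.1 (e n).not ∧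
        ∀ ψ : L.BoundedFormula ℕ 1, e n = ψ.all → ∃ t, Derives Δ'.1 (inst ψ t).not) := by
    intro n Δ
    obtain ⟨Δ', h₁, h₂, h₃, h₄⟩ := exists_extension Δ.2.1 Δ.2.2 (e n)
    exact ⟨⟨Δ', h₂, h₃⟩, h₁, h₄⟩
  choose next hsub hdec using hstep
  let G : ℕ → S := fun n => Nat.rec ⟨Γ, hΓ, hf⟩ next n
  have hG : Monotone fun n => (G n).1 := monotone_nat_of_le_succ fun n => hsub n (G n)
  let H : Set (L.Formula ℕ) := {φ | ∃ n, Derives (G n).1 φ}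
  have hmp : ∀ {φ ψ : L.Formula ℕ}, φ.imp ψ ∈ H → φ ∈ H → ψ ∈ H := by
    rintro φ ψ ⟨n, hn⟩ ⟨m, hm⟩
    exact ⟨max n m, .impE (hn.mono (hG (le_max_left _ _))) (hm.mono (hG (le_max_right _ _)))⟩
  have hbot : BoundedFormula.falsum ∉ H := fun ⟨n, hn⟩ => (G n).2.1 hn
  have hcomplete : ∀ φ : L.Formula ℕ, φ ∈ H ∨ φ.not ∈ H ∧
      ∀ ψ : L.BoundedFormula ℕ 1, φ = ψ.all → ∃ t, (inst ψ t).not ∈ H := by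
    intro φ
    obtain ⟨n, rfl⟩ := he φ
    rcases hdec n (G n) with h | ⟨h, h'⟩
    · exact Or.inl ⟨n + 1, h⟩
    · refine Or.inr ⟨⟨n + 1, h⟩, fun ψ hψ => ?_⟩
      obtain ⟨t, ht⟩ := h' ψ hψ
      exact ⟨t, n + 1, ht⟩
  refine ⟨H, fun φ hφ => ⟨0, .hyp hφ⟩, hbot, fun φ ψ => ⟨hmp, fun h => ?_⟩,
    fun φ => ⟨fun ⟨n, hn⟩ t => ⟨n, .allE t hn⟩, fun h => ?_⟩, fun t => ⟨0, .eqRefl t⟩, ?_⟩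
  · rcases hcomplete φ with hφ | ⟨⟨n, hn⟩, -⟩
    · obtain ⟨n, hn⟩ := h hφ
      exact ⟨n, .impI (hn.mono (Set.subset_insert _ _))⟩
    · refine ⟨n, .impI (.exfalso (.impE (hn.mono (Set.subset_insert _ _)) (.hyp ?_)))⟩
      exact Set.mem_insert _ _
  · rcases hcomplete φ.all with hφ | ⟨-, hφ⟩
    · exact hφ
    · obtain ⟨t, ht⟩ := hφ φ rfl
      exact absurd (hmp ht (h t)) hbot
  · rintro φ s t ⟨n, hn⟩ ⟨m, hm⟩
    exact ⟨max n m, .eqSubst (hn.mono (hG (le_max_left _ _))) (hm.mono (hG (le_max_right _ _)))⟩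

/-- The completeness theorem for theories in a countable language. -/
theorem Consistent.exists_model [Countable (L.Formula ℕ)] {T : L.Theory} (hT : Consistent T) :
    ∃ (M : Type u) (_ : L.Structure M), M ⊨ T := by
  have hf : ∀ᶠ m in Filter.atTop, ∀ ψ ∈
      (fun σ : L.Sentence => Formula.relabel (Empty.elim : Empty → ℕ) σ) '' T, IsFresh m ψ := by
    refine Filter.Eventually.of_forall fun m => ?_
    rintro _ ⟨σ, -, rfl⟩ f g -
    simp only [Formula.relabel, BoundedFormula.subst_eq_sub, BoundedFormula.relabel_eq_sub,
      BoundedFormula.sub_sub]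
    congr 1
    funext x
    rcases x with a | i
    · exact a.elim
    · exact Fin.elim0 i
  obtain ⟨H, hTH, hH⟩ := exists_isHenkin hT hf
  refine ⟨hH.TermModel, hH.structureTermModel, ⟨fun σ hσ => ?_⟩⟩
  have h : instAll (Formula.relabel (Empty.elim : Empty → ℕ) σ) default ∈ H := by
    convert hTH ⟨σ, hσ, rfl⟩ using 1
    refine Eq.trans ?_ (BoundedFormula.sub_var _)
    rw [instAll]
    congr 1
    funext x
    rcases x with a | i
    · rfl
    · exact Fin.elim0 i
  have h' : Formula.Realize (M := hH.TermModel) (Formula.relabel (Empty.elim : Empty → ℕ) σ)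
      (fun j => hH.ofTerm (Term.var j)) := by
    rw [Formula.Realize, Subsingleton.elim (default : Fin 0 → hH.TermModel)]
    exact (hH.realize_iff _ _).2 h
  rw [Formula.realize_relabel, Subsingleton.elim (_ ∘ Empty.elim) default] at h'
  exact h'

theorem consistent_of_model {T : L.Theory} (M : Type*) [L.Structure M] [Nonempty M]
    (hM : M ⊨ T) : Consistent T := by
  intro h
  refine h.sound (M := M) (fun _ => Classical.arbitrary M) ?_
  rintro _ ⟨σ, hσ, rfl⟩
  rw [Formula.realize_relabel, Subsingleton.elim (_ ∘ Empty.elim) default]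
  exact hM.realize_of_mem σ hσ

theorem countable_formula {L : FirstOrder.Language.{0, 0}} (h : L.card ≤ Cardinal.aleph0) :
    Countable (L.Formula ℕ) := by
  have : Countable (Σ n, L.BoundedFormula ℕ n) := by
    rw [← Cardinal.mk_le_aleph0_iff]
    exact BoundedFormula.card_le.trans (by simpa using h)
  exact Function.Injective.countable (f := fun φ : L.Formula ℕ => (⟨0, φ⟩ : Σ n, _))
    fun φ ψ h => by simpa using h

end FirstOrder.Language

namespace Arith

theorem card_arith_le : arith.card ≤ Cardinal.aleph0 := by
  have h₁ : Countable (Σ n, arith.Functions n) :=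
    Function.Surjective.countable (f := (![⟨0, Func.zero⟩, ⟨0, Func.one⟩, ⟨2, Func.add⟩,
      ⟨2, Func.mul⟩] : Fin 4 → Σ n, Func n)) (by
        rintro ⟨_, _ | _ | _ | _⟩
        exacts [⟨0, rfl⟩, ⟨1, rfl⟩, ⟨2, rfl⟩, ⟨3, rfl⟩])
  have h₂ : Countable (Σ n, arith.Relations n) :=
    Function.Surjective.countable (f := fun _ : Unit => (⟨2, Rel.lt⟩ : Σ n, Rel n)) (by
      rintro ⟨_, ⟨⟩⟩
      exact ⟨(), rfl⟩)
  have : Countable arith.Symbols := inferInstanceAs (Countable (_ ⊕ _))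
  exact Cardinal.mk_le_aleph0_iff.2 this

instance : Countable (arith[[ℕ]].Formula ℕ) :=
  countable_formula (by simpa [card_withConstants] using card_arith_le)

/-! ### Discrete ordered semirings as structures for the language of arithmetic -/

section Operations

variable (M : Type*) [arith.Structure M]

/-- The interpretation of `0`, as an instance. -/
abbrev zeroInst : Zero M := ⟨(zeroSym : M)⟩
/-- The interpretation of `1`, as an instance. -/
abbrev oneInst : One M := ⟨(oneSym : M)⟩
/-- The interpretation of `+`, as an instance. -/
abbrev addInst : Add M := ⟨addIn M⟩
/-- The interpretation of `·`, as an instance. -/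
abbrev mulInst : Mul M := ⟨mulIn M⟩
/-- The interpretation of `<`, as an instance. -/
abbrev ltInst : LT M := ⟨ltIn M⟩

end Operations

attribute [local instance] zeroInst oneInst addInst mulInst ltInst

section Realize

variable {M : Type*} [arith.Structure M] {α : Type*} (v : α → M)

@[simp] theorem realize_term_zero : (0 : arith.Term α).realize v = 0 :=
  Term.realize_constants

@[simp] theorem realize_term_one : (1 : arith.Term α).realize v = 1 :=
  Term.realize_constants

@[simp] theorem realize_term_add (s t : arith.Term α) :
    (s + t).realize v = s.realize v + t.realize v :=
  Term.realize_functions_apply₂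

@[simp] theorem realize_term_mul (s t : arith.Term α) :
    (s * t).realize v = s.realize v * t.realize v :=
  Term.realize_functions_apply₂

@[simp] theorem realize_lt {n : ℕ} (s t : arith.Term (α ⊕ Fin n)) (xs : Fin n → M) :
    (lt s t).Realize v xs ↔ s.realize (Sum.elim v xs) < t.realize (Sum.elim v xs) :=
  BoundedFormula.realize_rel₂

end Realize

/-- The laws of a discretely ordered commutative semiring with least element `0`, for the
interpretations of the symbols of arithmetic. -/
structure IsDiscreteOrderedSemiring (M : Type*) [arith.Structure M] : Prop where
  add_zero (x : M) : x + 0 = x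
  add_comm (x y : M) : x + y = y + x
  add_assoc (x y z : M) : x + y + z = x + (y + z)
  mul_zero (x : M) : x * 0 = 0
  mul_one (x : M) : x * 1 = x
  mul_comm (x y : M) : x * y = y * x
  mul_assoc (x y z : M) : x * y * z = x * (y * z)
  mul_add (x y z : M) : x * (y + z) = x * y + x * z
  irrefl (x : M) : ¬ x < x
  trans (x y z : M) : x < y → y < z → x < z
  trichotomy (x y : M) : x < y ∨ x = y ∨ y < x
  zero_or_pos (x : M) : x = 0 ∨ 0 < x
  lt_succ (x y : M) : x < y + 1 ↔ x < y ∨ x = y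
  exists_pred (x : M) : x ≠ 0 → ∃ y, x = y + 1
  add_lt_add (x y z : M) : x < y → x + z < y + z
  mul_lt_mul (x y z : M) : x < y → x * (z + 1) < y * (z + 1)

namespace IsDiscreteOrderedSemiring

variable {M : Type*} [arith.Structure M] (h : IsDiscreteOrderedSemiring M)

include h

theorem lt_succ_self (x : M) : x < x + 1 := (h.lt_succ x x).2 (Or.inr rfl)

theorem not_lt_of_lt {x y : M} (hxy : x < y) : ¬ y < x := fun hyx =>
  h.irrefl x (h.trans _ _ _ hxy hyx)

theorem zero_add_one : (0 + 1 : M) = 1 := by rw [h.add_comm, h.add_zero]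

theorem not_between (x y : M) : ¬ (x < y ∧ y < x + 1) := by
  rintro ⟨h₁, h₂⟩
  rcases (h.lt_succ _ _).1 h₂ with h₂ | rfl
  · exact h.not_lt_of_lt h₁ h₂
  · exact h.irrefl _ h₁

theorem models_peanoBasic : M ⊨ peanoBasic := by
  refine ⟨fun σ hσ => ?_⟩
  simp only [peanoBasic, Set.mem_insert_iff, Set.mem_singleton_iff] at hσ
  rcases hσ with rfl | rfl | rfl | rfl | rfl | rfl | rfl | rfl | rfl | rfl | rfl | rfl | rfl | rfl |
    rfl <;> simp [Sentence.Realize, Formula.Realize, Fin.snoc]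
  · exact h.add_assoc
  · exact h.mul_assoc
  · exact fun a => ⟨h.add_zero a, by rw [h.add_comm, h.add_zero]⟩
  · exact fun a => ⟨h.mul_one a, by rw [h.mul_comm, h.mul_one]⟩
  · exact h.mul_add
  · intro a b c
    rw [h.mul_comm, h.mul_add, h.mul_comm c, h.mul_comm c]
  · exact h.irrefl
  · exact h.trans
  · exact h.trichotomy
  · exact h.zero_or_pos
  · exact fun a => ⟨_, h.lt_succ_self a⟩
  · exact fun a => ⟨_, h.lt_succ_self a, fun b h₁ h₂ => h.not_between a b ⟨h₁, h₂⟩⟩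
  · intro a ha
    obtain ⟨b, rfl⟩ := h.exists_pred a ha
    exact ⟨b, h.lt_succ_self b, fun x h₁ h₂ => h.not_between b x ⟨h₁, h₂⟩⟩
  · rw [← h.zero_add_one]
    exact ⟨h.lt_succ_self 0, fun x h₁ h₂ => h.not_between 0 x ⟨h₁, h₂⟩⟩
  · exact h.add_lt_add

/-- A discretely ordered semiring as an instance of Mathlib's algebraic classes. -/
abbrev commSemiring : CommSemiring M where
  add_zero := h.add_zero
  zero_add x := by rw [h.add_comm, h.add_zero]
  add_comm := h.add_comm
  add_assoc := h.add_assoc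
  mul_zero := h.mul_zero
  zero_mul x := by rw [h.mul_comm, h.mul_zero]
  mul_one := h.mul_one
  one_mul x := by rw [h.mul_comm, h.mul_one]
  mul_comm := h.mul_comm
  mul_assoc := h.mul_assoc
  left_distrib := h.mul_add
  right_distrib x y z := by rw [h.mul_comm, h.mul_add, h.mul_comm z, h.mul_comm z]
  nsmul := nsmulRec
  npow := npowRec

/-- The linear order of a discretely ordered semiring. -/
noncomputable abbrev linearOrder : LinearOrder M where
  le x y := x < y ∨ x = y
  le_refl x := Or.inr rfl
  le_trans x y z := by
    rintro (h₁ | rfl) (h₂ | rfl)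
    exacts [Or.inl (h.trans _ _ _ h₁ h₂), Or.inl h₁, Or.inl h₂, Or.inr rfl]
  le_antisymm x y := by
    rintro (h₁ | rfl) (h₂ | h₂)
    exacts [absurd h₂ (h.not_lt_of_lt h₁), h₂.symm, rfl, rfl]
  le_total x y := by
    rcases h.trichotomy x y with h | h | h
    exacts [Or.inl (Or.inl h), Or.inl (Or.inr h), Or.inr (Or.inl h)]
  lt_iff_le_not_ge x y := by
    refine ⟨fun hxy => ⟨Or.inl hxy, ?_⟩, fun ⟨h₁, h₂⟩ => h₁.resolve_right fun e =>
      h₂ (Or.inr e.symm)⟩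
    rintro (h' | rfl)
    exacts [h.not_lt_of_lt hxy h', h.irrefl _ hxy]
  toDecidableLE := Classical.decRel _

theorem isStrictOrderedRing :
    @IsStrictOrderedRing M h.commSemiring.toSemiring h.linearOrder.toPartialOrder :=
  letI := h.commSemiring
  letI := h.linearOrder
  have hadd : ∀ x y : M, x ≤ y → ∀ z, x + z ≤ y + z := fun x y hxy z =>
    hxy.elim (fun h' => Or.inl (h.add_lt_add _ _ _ h')) fun e => Or.inr (e ▸ rfl)
  have hmul : ∀ x y z : M, 0 < z → x < y → x * z < y * z := fun x y z hz hxy => by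
    obtain ⟨w, rfl⟩ := h.exists_pred z (fun e => h.irrefl 0 (by subst e; exact hz))
    exact h.mul_lt_mul _ _ _ hxy
  have hcancel : ∀ x y z : M, z + x ≤ z + y → x ≤ y := fun x y z hxy => by
    by_contra hlt
    have := h.add_lt_add _ _ z (not_le.1 hlt)
    rw [h.add_comm y, h.add_comm x] at this
    exact not_le.2 this hxy
  { add_le_add_left := hadd
    le_of_add_le_add_left := fun z x y => hcancel x y z
    zero_le_one := Or.inl (h.zero_add_one ▸ h.lt_succ_self 0)
    exists_pair_ne := ⟨0, 1, fun e => h.irrefl 0 (by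
      have := h.lt_succ_self (0 : M)
      rwa [h.zero_add_one, ← e] at this)⟩
    mul_lt_mul_of_pos_left := fun z hz x y hxy => by
      rw [h.mul_comm z, h.mul_comm z]
      exact hmul _ _ _ hz hxy
    mul_lt_mul_of_pos_right := fun z hz x y hxy => hmul _ _ _ hz hxy }

end IsDiscreteOrderedSemiring

section SquareGrowth

variable {R : Type*} [CommSemiring R] [LinearOrder R] [IsStrictOrderedRing R] {c : ℕ → R}

theorem strictMono_of_sq_lt (h₀ : ∀ x : R, 0 ≤ x) (h₁ : ∀ x y : R, x < y → x + 1 ≤ y)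
    (hc : ∀ i, c i * c i < c (i + 1)) : StrictMono c := by
  refine strictMono_nat_of_lt_succ fun i => ?_
  rcases (h₀ (c i)).eq_or_lt with h | h
  · simpa [← h] using hc i
  · have h1 : 1 ≤ c i := by simpa using h₁ _ _ h
    exact (le_mul_of_one_le_right (h₀ _) h1).trans_lt (hc i)

/-- Sums and products of elements below the `c i` are below some `c k`, as `2 ≤ c m` for `2 ≤ m` and
so `c m + c m ≤ c m * c m < c (m + 1)`. -/
theorem exists_bound_of_sq_lt (h₀ : ∀ x : R, 0 ≤ x) (h₁ : ∀ x y : R, x < y → x + 1 ≤ y)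
    (hc : ∀ i, c i * c i < c (i + 1)) {a b : R} {i j : ℕ} (ha : a < c i) (hb : b < c j) :
    ∃ k, 1 < c k ∧ a + b < c k ∧ a * b < c k := by
  have hmono := strictMono_of_sq_lt h₀ h₁ hc
  set m := max i j + 2 with hm
  have ha : a < c m := ha.trans_le (hmono.monotone (by omega))
  have hb : b < c m := hb.trans_le (hmono.monotone (by omega))
  -- `c 0` may be `0`, but then `c 1` is at least `1` and `c 2` at least `2`.
  have h2 : 1 + 1 ≤ c m :=
    calc (1 + 1 : R) ≤ c 1 + 1 := by
          gcongr
          simpa using h₁ _ _ ((h₀ (c 0)).trans_lt (hmono Nat.zero_lt_one))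
      _ ≤ c 2 := h₁ _ _ (hmono (by norm_num))
      _ ≤ c m := hmono.monotone (by omega)
  refine ⟨m + 1, ?_, ?_, ?_⟩
  · exact ((lt_add_one 1).trans_le h2).trans (hmono (Nat.lt_succ_self m))
  · calc a + b < c m + c m := add_lt_add ha hb
      _ = c m * (1 + 1) := by rw [mul_add, mul_one]
      _ ≤ c m * c m := mul_le_mul_of_nonneg_left h2 (h₀ _)
      _ < c (m + 1) := hc m
  · exact (mul_le_mul ha.le hb.le (h₀ _) (h₀ _)).trans_lt (hc m)

end SquareGrowth

/-! ### Arithmetic with limited induction -/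

theorem realize_substX {M : Type*} [arith.Structure M] {n : ℕ} {β : Type*}
    (φ : arith.Formula (Fin n ⊕ Fin 1)) (w : Fin n → arith.Term β) (t : arith.Term β) (v : β → M) :
    (substX φ w t).Realize v ↔
      φ.Realize (Sum.elim (fun j => (w j).realize v) fun _ => t.realize v) := by
  refine BoundedFormula.realize_subst.trans (iff_of_eq ?_)
  congr 1
  funext x
  rcases x with j | i <;> rfl

theorem realize_inductionAxiom {M : Type*} [arith.Structure M] {n : ℕ}
    (φ : arith.Formula (Fin n ⊕ Fin 1)) : M ⊨ inductionAxiom φ ↔ ∀ w : Fin n → M,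
      φ.Realize (Sum.elim w fun _ => 0) →
      (∀ x : M, φ.Realize (Sum.elim w fun _ => x) → φ.Realize (Sum.elim w fun _ => x + 1)) →
      ∀ x : M, φ.Realize (Sum.elim w fun _ => x) := by
  have hx : ∀ (w : Fin n → M) (P : (Fin n ⊕ Fin 1 → M) → Prop),
      (∀ i : Fin 1 → M, P fun a => Sum.elim w i a) ↔ ∀ x, P (Sum.elim w fun _ => x) :=
    fun w P => ⟨fun h x => h fun _ => x, fun h i => by
      obtain ⟨x, rfl⟩ : ∃ x, i = fun _ => x :=
        ⟨i 0, funext fun j => by rw [Subsingleton.elim j 0]⟩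
      exact h x⟩
  rw [inductionAxiom, Sentence.Realize, Formula.realize_iAlls]
  refine forall_congr' fun w => ?_
  rw [Formula.realize_relabel, Formula.realize_imp, Formula.realize_inf, Formula.realize_iAlls,
    Formula.realize_iAlls, realize_substX]
  have hw : (fun a => Sum.elim (default : Empty → M) w a) ∘ Sum.inr = w := rfl
  rw [hw, hx w fun v => φ.Realize v, hx w fun v => Formula.Realize (φ ⟹ _) v, and_imp]
  simp only [Formula.realize_imp, realize_substX, Term.realize_var, realize_term_zero,
    realize_term_add, realize_term_one, Sum.elim_inl, Sum.elim_inr]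

section LimitedInduction

variable {U : Type*} [arith.Structure U]

/-- Limited induction for a property `P` of elements, defined by `φ` with parameters `w`. -/
theorem IsLimited.induction (hU : U ⊨ limitedInduction) {n : ℕ}
    {φ : arith.Formula (Fin n ⊕ Fin 1)} (hφ : IsLimited φ) (w : Fin n → U) {P : U → Prop}
    (hP : ∀ x, φ.Realize (Sum.elim w fun _ => x) ↔ P x) (zero : P 0)
    (succ : ∀ x, P x → P (x + 1)) (x : U) : P x := by
  have h := (realize_inductionAxiom φ).1 (hU.realize_of_mem _ ⟨n, φ, hφ, rfl⟩) w
  simp only [hP] at h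
  exact h zero succ x

/-- The first parameter `a` of a formula for induction on `x` with parameters `a, b`. -/
abbrev varA : arith.Term ((Fin 2 ⊕ Fin 1) ⊕ Fin 0) := Term.var (Sum.inl (Sum.inl 0))
/-- The second parameter `b` of a formula for induction on `x` with parameters `a, b`. -/
abbrev varB : arith.Term ((Fin 2 ⊕ Fin 1) ⊕ Fin 0) := Term.var (Sum.inl (Sum.inl 1))
/-- The induction variable `x` of a formula with parameters `a, b`. -/
abbrev varX : arith.Term ((Fin 2 ⊕ Fin 1) ⊕ Fin 0) := Term.var (Sum.inl (Sum.inr 0))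

/-- Induction for an equation. -/
theorem equation_induction (hU : U ⊨ limitedInduction) (a b : U)
    (s t : arith.Term ((Fin 2 ⊕ Fin 1) ⊕ Fin 0)) {f g : U → U}
    (hf : ∀ x, s.realize (Sum.elim (Sum.elim ![a, b] fun _ => x) default) = f x)
    (hg : ∀ x, t.realize (Sum.elim (Sum.elim ![a, b] fun _ => x) default) = g x)
    (zero : f 0 = g 0) (succ : ∀ x, f x = g x → f (x + 1) = g (x + 1)) (x : U) : f x = g x :=
  (IsLimited.equal s t).induction hU ![a, b] (P := fun x => f x = g x)
    (fun x => by simp [Formula.Realize, BoundedFormula.Realize, hf, hg]) zero succ x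

theorem isLimited_lt {α : Type*} {n : ℕ} (s t : arith.Term (α ⊕ Fin n)) : IsLimited (lt s t) :=
  IsLimited.rel _ _

theorem IsLimited.not {α : Type*} {n : ℕ} {φ : arith.BoundedFormula α n} (h : IsLimited φ) :
    IsLimited φ.not :=
  h.imp .falsum

theorem IsLimited.sup {α : Type*} {n : ℕ} {φ ψ : arith.BoundedFormula α n} (h : IsLimited φ)
    (h' : IsLimited ψ) : IsLimited (φ ⊔ ψ) :=
  h.not.imp h'

theorem models_recursionAxioms_iff : U ⊨ recursionAxioms ↔
    (∀ x : U, x + 0 = x) ∧ (∀ x y : U, x + (y + 1) = x + y + 1) ∧ (∀ x : U, x * 0 = 0) ∧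
    (∀ x y : U, x * (y + 1) = x * y + x) ∧ (∀ x : U, ¬ x < 0) ∧
    ∀ x y : U, x < y + 1 ↔ x < y ∨ x = y := by
  simp [Theory.model_iff, recursionAxioms, Sentence.Realize, Formula.Realize, Fin.snoc]

/-- The recursion equations and limited induction already give the algebraic laws; all the inductions
are on quantifier-free formulas. -/
theorem isDiscreteOrderedSemiring (hR : U ⊨ recursionAxioms) (hU : U ⊨ limitedInduction) :
    IsDiscreteOrderedSemiring U := by
  obtain ⟨add_zero, add_succ, mul_zero, mul_succ, not_lt_zero, lt_succ⟩ :=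
    models_recursionAxioms_iff.1 hR
  have zero_add : ∀ x : U, 0 + x = x := equation_induction hU 0 0 (0 + varX) varX
    (fun _ => by simp) (fun _ => by simp) (add_zero 0) fun x h => by rw [add_succ, h]
  have succ_add : ∀ x y : U, x + 1 + y = x + y + 1 := fun x =>
    equation_induction hU x x (varA + 1 + varX) (varA + varX + 1)
      (fun _ => by simp) (fun _ => by simp) (by rw [add_zero, add_zero])
      fun y h => by rw [add_succ, add_succ, h]
  have add_comm : ∀ x y : U, x + y = y + x := fun x =>
    equation_induction hU x x (varA + varX) (varX + varA)
      (fun _ => by simp) (fun _ => by simp) (by rw [add_zero, zero_add])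
      fun y h => by rw [add_succ, succ_add, h]
  have add_assoc : ∀ x y z : U, x + y + z = x + (y + z) := fun x y =>
    equation_induction hU x y (varA + varB + varX) (varA + (varB + varX))
      (fun _ => by simp) (fun _ => by simp) (by rw [add_zero, add_zero])
      fun z h => by rw [add_succ, add_succ, add_succ, h]
  have mul_one : ∀ x : U, x * 1 = x := fun x => by
    rw [← zero_add 1, mul_succ, mul_zero, zero_add]
  have zero_mul : ∀ x : U, 0 * x = 0 := equation_induction hU 0 0 (0 * varX) 0
    (fun _ => by simp) (fun _ => by simp) (mul_zero 0) fun x h => by rw [mul_succ, h, add_zero]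
  have succ_mul : ∀ x y : U, (x + 1) * y = x * y + y := fun x =>
    equation_induction hU x x ((varA + 1) * varX) (varA * varX + varX)
      (fun _ => by simp) (fun _ => by simp) (by rw [mul_zero, mul_zero, add_zero])
      fun y h => by
        rw [mul_succ (x + 1), mul_succ x, h, add_assoc, add_assoc, add_succ y x, add_succ x y,
          add_comm y]
  have mul_comm : ∀ x y : U, x * y = y * x := fun x =>
    equation_induction hU x x (varA * varX) (varX * varA)
      (fun _ => by simp) (fun _ => by simp) (by rw [mul_zero, zero_mul])
      fun y h => by rw [mul_succ, succ_mul, h]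
  have mul_add : ∀ x y z : U, x * (y + z) = x * y + x * z := fun x y =>
    equation_induction hU x y (varA * (varB + varX)) (varA * varB + varA * varX)
      (fun _ => by simp) (fun _ => by simp) (by rw [add_zero, mul_zero, add_zero])
      fun z h => by rw [add_succ, mul_succ, mul_succ, h, add_assoc]
  have mul_assoc : ∀ x y z : U, x * y * z = x * (y * z) := fun x y =>
    equation_induction hU x y (varA * varB * varX) (varA * (varB * varX))
      (fun _ => by simp) (fun _ => by simp) (by rw [mul_zero, mul_zero, mul_zero])
      fun z h => by rw [mul_succ, mul_succ, mul_add, h]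
  have lt_succ_self : ∀ x : U, x < x + 1 := fun x => (lt_succ x x).2 (Or.inr rfl)
  have trans : ∀ x y z : U, x < y → y < z → x < z := fun x y z hxy =>
    ((isLimited_lt varB varX).imp (isLimited_lt varA varX)).induction hU ![x, y]
      (P := fun z => y < z → x < z) (fun _ => by simp [Formula.Realize])
      (fun h => absurd h (not_lt_zero y))
      (fun z ih h => (lt_succ _ _).2 (Or.inl (((lt_succ _ _).1 h).elim ih fun e => e ▸ hxy))) z
  have zero_or_pos : ∀ x : U, x = 0 ∨ 0 < x :=
    ((IsLimited.equal varX 0).sup (isLimited_lt 0 varX)).induction hU ![0, 0]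
      (P := fun x => x = 0 ∨ 0 < x)
      (fun _ => by simp [Formula.Realize, BoundedFormula.Realize]) (Or.inl rfl)
      fun x ih => Or.inr ((lt_succ _ _).2 (ih.elim (fun e => Or.inr e.symm) Or.inl))
  have succ_lt_succ : ∀ x y : U, x < y → x + 1 < y + 1 := fun x =>
    ((isLimited_lt varA varX).imp (isLimited_lt (varA + 1) (varX + 1))).induction hU ![x, x]
      (P := fun y => x < y → x + 1 < y + 1) (fun _ => by simp [Formula.Realize])
      (fun h => absurd h (not_lt_zero x)) fun y ih h => by
        rcases (lt_succ _ _).1 h with h | rfl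
        · exact trans _ _ _ (ih h) (lt_succ_self _)
        · exact lt_succ_self _
  have trichotomy : ∀ x y : U, x < y ∨ x = y ∨ y < x := fun x y =>
    ((isLimited_lt varX varA).sup ((IsLimited.equal varX varA).sup
      (isLimited_lt varA varX))).induction hU ![y, y]
      (P := fun x => x < y ∨ x = y ∨ y < x)
      (fun _ => by simp [Formula.Realize, BoundedFormula.Realize])
      ((zero_or_pos y).elim (fun e => Or.inr (Or.inl e.symm)) Or.inl) (fun x ih => by
        rcases ih with h | rfl | h
        · rcases (lt_succ _ _).1 (succ_lt_succ _ _ h) with h | h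
          exacts [Or.inl h, Or.inr (Or.inl h)]
        · exact Or.inr (Or.inr (lt_succ_self _))
        · exact Or.inr (Or.inr ((lt_succ _ _).2 (Or.inl h)))) x
  have irrefl : ∀ x : U, ¬ x < x :=
    (isLimited_lt varX varX).not.induction hU ![0, 0] (P := fun x => ¬ x < x)
      (fun _ => by simp [Formula.Realize]) (not_lt_zero 0) fun x ih h => by
        rcases (lt_succ _ _).1 h with h | h
        · exact ih (trans _ _ _ (lt_succ_self x) h)
        · exact ih (by simpa [h] using lt_succ_self x)
  have add_lt_add : ∀ x y z : U, x < y → x + z < y + z := fun x y z hxy =>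
    (isLimited_lt (varA + varX) (varB + varX)).induction hU ![x, y]
      (P := fun z => x + z < y + z) (fun _ => by simp [Formula.Realize])
      (by rwa [add_zero, add_zero])
      (fun z ih => by rw [add_succ, add_succ]; exact succ_lt_succ _ _ ih) z
  refine ⟨add_zero, add_comm, add_assoc, mul_zero, mul_one, mul_comm, mul_assoc, mul_add, irrefl,
    trans, trichotomy, zero_or_pos, lt_succ, fun x hx => ?_, add_lt_add, fun x y z hxy => ?_⟩
  · -- If `x ≠ 0` had no predecessor, then the elements below `x` would be closed under successor.
    by_contra hpred
    push Not at hpred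
    refine irrefl x ((isLimited_lt varX varA).induction hU ![x, x] (P := fun y => y < x)
      (fun _ => by simp [Formula.Realize]) ((zero_or_pos x).resolve_left hx) (fun y hy => ?_) x)
    exact ((lt_succ _ _).1 (succ_lt_succ _ _ hy)).resolve_right fun h => hpred y h.symm
  · refine (isLimited_lt (varA * (varX + 1)) (varB * (varX + 1))).induction hU ![x, y]
      (P := fun z => x * (z + 1) < y * (z + 1)) (fun _ => by simp [Formula.Realize])
      (by rwa [zero_add, mul_one, mul_one]) (fun z ih => ?_) z
    rw [mul_succ x, mul_succ y]
    refine trans _ _ _ (add_lt_add _ _ _ ih) ?_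
    rw [add_comm _ x, add_comm _ y]
    exact add_lt_add _ _ _ hxy

end LimitedInduction

/-! ### Limited formulas and the bounded translation -/

theorem sub_lt {α β : Type*} {n m : ℕ} (σ : α ⊕ Fin n → arith.Term (β ⊕ Fin m))
    (s t : arith.Term (α ⊕ Fin n)) :
    BoundedFormula.sub σ (lt s t) = lt (s.subst σ) (t.subst σ) := by
  simp only [lt, Relations.boundedFormula₂, Relations.boundedFormula, BoundedFormula.sub]
  congr 1
  funext i
  fin_cases i <;> rfl

theorem IsLimited.sub {α β : Type*} {n m : ℕ} {φ : arith.BoundedFormula α n} (h : IsLimited φ)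
    (σ : α ⊕ Fin n → arith.Term (β ⊕ Fin m)) : IsLimited (BoundedFormula.sub σ φ) := by
  have hb : ∀ {n m : ℕ} (σ : α ⊕ Fin n → arith.Term (β ⊕ Fin m)) (t : arith.Term (α ⊕ Fin n)),
      BoundedFormula.sub (liftSub σ)
        (lt (&(Fin.last n)) (t.relabel (Sum.map id Fin.castSucc))) =
      lt (&(Fin.last m)) ((t.subst σ).relabel (Sum.map id Fin.castSucc)) := by
    intro n m σ t
    rw [sub_lt]
    congr 1
    · simp
    · rw [Term.subst_relabel, Term.relabel_eq_subst, Term.subst_subst]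
      congr 1
      funext x
      rw [← Term.relabel_eq_subst]
      rcases x with a | i <;> simp
  induction h generalizing m with
  | falsum => exact .falsum
  | equal s t => exact .equal _ _
  | rel R ts => exact .rel _ _
  | imp _ _ ih₁ ih₂ => exact (ih₁ σ).imp (ih₂ σ)
  | all_lt t _ ih =>
    simp only [BoundedFormula.sub, hb]
    exact .all_lt _ (ih _)
  | ex_lt t _ ih =>
    have hex : ∀ {n : ℕ} (ψ χ : arith.BoundedFormula α (n + 1))
        (σ : α ⊕ Fin n → arith.Term (β ⊕ Fin m)), BoundedFormula.sub σ (∃' (ψ ⊓ χ)) =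
        ∃' (BoundedFormula.sub (liftSub σ) ψ ⊓ BoundedFormula.sub (liftSub σ) χ) :=
      fun _ _ _ => rfl
    rw [hex, hb]
    exact .ex_lt _ (ih _)

theorem isLimited_boundedTranslation {α : Type*} {n : ℕ} (θ : arith.BoundedFormula α n) (d : ℕ) :
    IsLimited (boundedTranslation d θ) := by
  induction θ generalizing d with
  | falsum => exact .falsum
  | equal s t => exact .equal _ _
  | rel R ts => exact .rel _ _
  | imp φ ψ ih₁ ih₂ => exact (ih₁ d).imp (ih₂ d)
  | all φ ih => exact .all_lt (Term.var (Sum.inl (Sum.inr d))) (ih (d + 1))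

section Realize

variable {U : Type*} [arith.Structure U] {α : Type*} {n : ℕ}

theorem realize_boundedTranslation_equal (d : ℕ) (s t : arith.Term (α ⊕ Fin n)) (v : α → U)
    (z : ℕ → U) (xs : Fin n → U) :
    (boundedTranslation d (.equal s t)).Realize (Sum.elim v z) xs ↔
      s.realize (Sum.elim v xs) = t.realize (Sum.elim v xs) := by
  have : Sum.elim (Sum.elim v z) xs ∘ Sum.map Sum.inl id = Sum.elim v xs := by
    funext x
    rcases x with a | i <;> rfl
  simp [boundedTranslation, BoundedFormula.Realize, this]

theorem realize_boundedTranslation_rel (d : ℕ) {l : ℕ} (R : arith.Relations l)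
    (ts : Fin l → arith.Term (α ⊕ Fin n)) (v : α → U) (z : ℕ → U) (xs : Fin n → U) :
    (boundedTranslation d (.rel R ts)).Realize (Sum.elim v z) xs ↔
      Structure.RelMap R fun i => (ts i).realize (Sum.elim v xs) := by
  have : Sum.elim (Sum.elim v z) xs ∘ Sum.map Sum.inl id = Sum.elim v xs := by
    funext x
    rcases x with a | i <;> rfl
  simp [boundedTranslation, BoundedFormula.Realize, this]

theorem realize_boundedTranslation_all (d : ℕ) (φ : arith.BoundedFormula α (n + 1)) (v : α → U)
    (z : ℕ → U) (xs : Fin n → U) :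
    (boundedTranslation d φ.all).Realize (Sum.elim v z) xs ↔
      ∀ x, x < z d → (boundedTranslation (d + 1) φ).Realize (Sum.elim v z) (Fin.snoc xs x) := by
  simp [boundedTranslation]

end Realize

/-- The translation `θ*`, at depth `d`, uses only finitely many of the bounds `z_d, z_{d+1}, …`. -/
theorem exists_realize_boundedTranslation_congr {α : Type*} {n : ℕ} (θ : arith.BoundedFormula α n)
    (d : ℕ) (U : Type*) [arith.Structure U] :
    ∃ r, ∀ (v : α → U) (z z' : ℕ → U) (xs : Fin n → U), (∀ j, d ≤ j → j < r → z j = z' j) →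
      ((boundedTranslation d θ).Realize (Sum.elim v z) xs ↔
        (boundedTranslation d θ).Realize (Sum.elim v z') xs) := by
  induction θ generalizing d with
  | falsum => exact ⟨0, fun v z z' xs _ => Iff.rfl⟩
  | equal s t => exact ⟨0, fun v z z' xs _ => by simp only [realize_boundedTranslation_equal]⟩
  | rel R ts => exact ⟨0, fun v z z' xs _ => by simp only [realize_boundedTranslation_rel]⟩
  | imp φ ψ ih₁ ih₂ =>
    obtain ⟨r₁, h₁⟩ := ih₁ d
    obtain ⟨r₂, h₂⟩ := ih₂ d
    exact ⟨max r₁ r₂, fun v z z' xs h => imp_congr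
      (h₁ v z z' xs fun j hd hj => h j hd (hj.trans_le (le_max_left _ _)))
      (h₂ v z z' xs fun j hd hj => h j hd (hj.trans_le (le_max_right _ _)))⟩
  | all φ ih =>
    obtain ⟨r, hr⟩ := ih (d + 1)
    refine ⟨max r (d + 1), fun v z z' xs h => ?_⟩
    simp only [realize_boundedTranslation_all]
    rw [h d le_rfl (by simp)]
    refine forall_congr' fun x => imp_congr_right fun _ => hr v z z' _ fun j hd hj => ?_
    exact h j (by omega) (hj.trans_le (le_max_left _ _))

/-! ### The cut of a model of `T` -/

/-- `U`, with the elements `c i` for the constants, is a model of the theory `T`. -/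
structure IsIndiscernibleModel (U : Type*) [arith.Structure U] (c : ℕ → U) : Prop where
  semiring : IsDiscreteOrderedSemiring U
  induction : U ⊨ limitedInduction
  sq_lt (i : ℕ) : c i * c i < c (i + 1)
  indiscernible {r s : ℕ} (i : ℕ) (k k' : Fin r → ℕ) (ψ : arith.BoundedFormula (Fin r) s) :
    StrictMono k → StrictMono k' → (∀ j, i < k j) → (∀ j, i < k' j) → IsLimited ψ →
    ∀ y : Fin s → U, (∀ j, y j < c i) →
      (ψ.Realize (fun j => c (k j)) y ↔ ψ.Realize (fun j => c (k' j)) y)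

theorem isIndiscernibleModel (U : Type*) [arith.Structure U] [arith[[ℕ]].Structure U]
    [(arith.lhomWithConstants ℕ).IsExpansionOn U] (hU : U ⊨ theoryT) :
    IsIndiscernibleModel U (c U) := by
  have h₁ := (LHom.onTheory_model _ _).1 (hU.mono (Set.subset_union_left.trans
    Set.subset_union_left))
  have hI : U ⊨ limitedInduction := h₁.mono Set.subset_union_right
  refine ⟨isDiscreteOrderedSemiring (h₁.mono Set.subset_union_left) hI, hI, fun i => ?_, ?_⟩
  · have h := hU.realize_of_mem (squareAxiom i) (Or.inl (Or.inr ⟨i, rfl⟩))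
    rw [squareAxiom, Formula.realize_equivSentence] at h
    simpa [Formula.Realize] using! h
  · intro r s i k k' ψ hk hk' hi hi' hψ y hy
    have h := hU.realize_of_mem _ (Or.inr ⟨r, s, i, k, k', ψ, hk, hk', hi, hi', hψ, rfl⟩)
    rw [indiscernibilityAxiom, Formula.realize_equivSentence, BoundedFormula.realize_alls] at h
    have h := h y
    rw [BoundedFormula.realize_imp, BoundedFormula.realize_iInf, BoundedFormula.realize_iff,
      BoundedFormula.realize_subst, BoundedFormula.realize_subst] at h
    exact h fun j => by simpa using! hy j

namespace IsIndiscernibleModel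

variable {U : Type*} [arith.Structure U] {c : ℕ → U} (h : IsIndiscernibleModel U c)

include h

theorem lt_of_lt {i j : ℕ} (hij : i < j) : c i < c j :=
  letI := h.semiring.commSemiring
  letI := h.semiring.linearOrder
  letI := h.semiring.isStrictOrderedRing
  strictMono_of_sq_lt (fun x => (h.semiring.zero_or_pos x).elim (fun e => Or.inr e.symm) Or.inl)
    (fun x y hxy => by
      by_contra hlt
      exact h.semiring.not_between x y ⟨hxy, not_le.1 hlt⟩) h.sq_lt hij

theorem lt_of_lt_of_le {i j : ℕ} {a : U} (ha : a < c i) (hij : i ≤ j) : a < c j := by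
  rcases hij.eq_or_lt with rfl | hij
  · exact ha
  · exact h.semiring.trans _ _ _ ha (h.lt_of_lt hij)

/-- The cut is closed under `+` and `·`, and has the element `1`. -/
theorem exists_bound {a b : U} {i j : ℕ} (ha : a < c i) (hb : b < c j) :
    ∃ k, 1 < c k ∧ a + b < c k ∧ a * b < c k :=
  letI := h.semiring.commSemiring
  letI := h.semiring.linearOrder
  letI := h.semiring.isStrictOrderedRing
  exists_bound_of_sq_lt (fun x => (h.semiring.zero_or_pos x).elim (fun e => Or.inr e.symm) Or.inl)
    (fun x y hxy => by
      by_contra hlt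
      exact h.semiring.not_between x y ⟨hxy, not_le.1 hlt⟩) h.sq_lt ha hb

theorem zero_lt : 0 < c 1 := by
  rcases h.semiring.zero_or_pos (c 1) with h₁ | h₁
  · have := h.lt_of_lt Nat.zero_lt_one
    rw [h₁] at this
    rcases h.semiring.zero_or_pos (c 0) with h₀ | h₀
    · rw [h₀] at this
      exact absurd this (h.semiring.irrefl 0)
    · exact absurd this (h.semiring.not_lt_of_lt h₀)
  · exact h₁

theorem one_lt : ∃ k, 1 < c k := by
  obtain ⟨k, hk, -⟩ := h.exists_bound h.zero_lt h.zero_lt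
  exact ⟨k, hk⟩

/-- The initial segment of the elements below some `c i`, as a substructure. -/
def cutSubstructure : arith.Substructure U where
  carrier := {a | ∃ i, a < c i}
  fun_mem {n} f xs hxs := by
    cases f with
    | zero => exact ⟨1, by
        convert h.zero_lt using 1
        exact congrArg _ (Subsingleton.elim _ _)⟩
    | one =>
        obtain ⟨k, hk⟩ := h.one_lt
        exact ⟨k, by
          convert hk using 1
          exact congrArg _ (Subsingleton.elim _ _)⟩
    | add =>
        obtain ⟨i, hi⟩ := hxs 0
        obtain ⟨j, hj⟩ := hxs 1
        obtain ⟨k, -, hk, -⟩ := h.exists_bound hi hj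
        exact ⟨k, by
          convert hk using 1
          refine congrArg _ (funext fun i => ?_)
          fin_cases i <;> rfl⟩
    | mul =>
        obtain ⟨i, hi⟩ := hxs 0
        obtain ⟨j, hj⟩ := hxs 1
        obtain ⟨k, -, -, hk⟩ := h.exists_bound hi hj
        exact ⟨k, by
          convert hk using 1
          refine congrArg _ (funext fun i => ?_)
          fin_cases i <;> rfl⟩

/-- Indiscernibility for the translations `θ*`: the truth value of `θ*(a; c(k))` does not depend on
the increasing sequence `k` above a bound for the parameters. -/
theorem realize_boundedTranslation_congr {s n : ℕ} (θ : arith.BoundedFormula (Fin s) n) {d i : ℕ}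
    {k k' : ℕ → ℕ} (hk : StrictMono k) (hk' : StrictMono k') (hi : i < k d) (hi' : i < k' d)
    (a : Fin s → U) (xs : Fin n → U) (ha : ∀ j, a j < c i) (hxs : ∀ j, xs j < c i) :
    (boundedTranslation d θ).Realize (Sum.elim a fun e => c (k e)) xs ↔
      (boundedTranslation d θ).Realize (Sum.elim a fun e => c (k' e)) xs := by
  obtain ⟨r, hr⟩ := exists_realize_boundedTranslation_congr θ d U
  -- All parameters become bound variables, and `z_e` becomes the free variable `e - d`.
  let σ : (Fin s ⊕ ℕ) ⊕ Fin n → arith.Term (Fin (r - d + 1) ⊕ Fin (s + n)) :=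
    Sum.elim (Sum.elim (fun j => &(Fin.castAdd n j))
      fun e => Term.var (Sum.inl ⟨min (e - d) (r - d), by omega⟩)) fun j => &(Fin.natAdd s j)
  have key : ∀ {k : ℕ → ℕ},
      (BoundedFormula.sub σ (boundedTranslation d θ)).Realize
        (fun j : Fin (r - d + 1) => c (k (d + j))) (Fin.append a xs) ↔
      (boundedTranslation d θ).Realize (Sum.elim a fun e => c (k e)) xs := by
    intro k
    rw [BoundedFormula.realize_sub, ← hr a (fun e => c (k (d + min (e - d) (r - d))))]
    · refine iff_of_eq ?_
      congr 1
      · funext x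
        rcases x with j | e <;> simp [σ]
      · funext j
        simp [σ]
    · intro j hd hj
      congr 2
      omega
  rw [← key, ← key]
  refine h.indiscernible i (fun j => k (d + j)) (fun j => k' (d + j)) _
    (fun x y hxy => hk (by simpa using hxy)) (fun x y hxy => hk' (by simpa using hxy))
    (fun j => hi.trans_le (hk.monotone (by simp))) (fun j => hi'.trans_le (hk'.monotone (by simp)))
    ((isLimited_boundedTranslation θ d).sub σ) _ fun j => ?_
  induction j using Fin.addCases with
  | left j => simpa using ha j
  | right j => simpa using hxs j

theorem realize_term_cut {α : Type*} (t : arith.Term α) (v : α → h.cutSubstructure) :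
    ((t.realize v : h.cutSubstructure) : U) = t.realize fun x => (v x : U) :=
  (HomClass.realize_term h.cutSubstructure.subtype (t := t) (v := v)).symm

/-- Truth in the cut is truth of the bounded translation in the model. In the step for `∀ x`, an
element `x` of the cut is brought below the bound of the quantifier by raising the bounds, which
indiscernibility permits. -/
theorem realize_iff {s n : ℕ} (θ : arith.BoundedFormula (Fin s) n) {d i : ℕ} {k : ℕ → ℕ}
    (hk : StrictMono k) (hi : i < k d) (a : Fin s → h.cutSubstructure)
    (xs : Fin n → h.cutSubstructure) (ha : ∀ j, (a j : U) < c i) (hxs : ∀ j, (xs j : U) < c i) :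
    θ.Realize a xs ↔ (boundedTranslation d θ).Realize
      (Sum.elim (fun j => (a j : U)) fun e => c (k e)) fun j => (xs j : U) := by
  have hcoe : ∀ {n : ℕ} (xs : Fin n → h.cutSubstructure),
      (fun x => ((Sum.elim a xs x : h.cutSubstructure) : U)) =
        Sum.elim (fun j => (a j : U)) fun j => (xs j : U) := by
    intro n xs
    funext x
    rcases x with j | j <;> rfl
  induction θ generalizing d i k with
  | falsum => exact Iff.rfl
  | equal s t =>
    rw [realize_boundedTranslation_equal, ← hcoe, ← h.realize_term_cut, ← h.realize_term_cut]
    exact Subtype.ext_iff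
  | rel R ts =>
    rw [realize_boundedTranslation_rel, ← hcoe]
    simp only [← h.realize_term_cut]
    exact (StrongHomClass.map_rel h.cutSubstructure.subtype R _).symm
  | imp φ ψ ih₁ ih₂ => exact imp_congr (ih₁ hk hi xs ha hxs) (ih₂ hk hi xs ha hxs)
  | @all n φ ih =>
    have hsnoc : ∀ x : h.cutSubstructure,
        (fun j => ((Fin.snoc xs x : Fin (n + 1) → h.cutSubstructure) j : U)) =
          Fin.snoc (fun j => (xs j : U)) (x : U) := by
      intro x
      funext j
      induction j using Fin.lastCases <;> simp
    have hlt : ∀ {e : ℕ} {x : h.cutSubstructure}, i ≤ e → (x : U) < c e →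
        ∀ j, ((Fin.snoc xs x : Fin (n + 1) → h.cutSubstructure) j : U) < c e := by
      intro e x hie hx j
      induction j using Fin.lastCases with
      | last => simpa using hx
      | cast j => simpa using h.lt_of_lt_of_le (hxs j) hie
    rw [BoundedFormula.realize_all]
    constructor
    · intro hφ
      rw [realize_boundedTranslation_all]
      intro x hx
      have := (ih (d := d + 1) hk (hk (Nat.lt_succ_self d)) (Fin.snoc xs ⟨x, k d, hx⟩)
        (fun j => h.lt_of_lt_of_le (ha j) hi.le) (hlt hi.le hx)).1 (hφ _)
      rwa [hsnoc] at this
    · intro hφ x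
      obtain ⟨b, hb⟩ := x.2
      have hk' : StrictMono fun e => k e + b := fun e e' hee => Nat.add_lt_add_right (hk hee) b
      have hi' : i < k d + b := by omega
      have hall := (h.realize_boundedTranslation_congr φ.all hk hk' hi hi' _ _ ha hxs).1 hφ
      rw [realize_boundedTranslation_all] at hall
      have hx : (x : U) < c (k d + b) := h.lt_of_lt_of_le hb (by omega)
      have := hall x hx
      rw [← hsnoc] at this
      exact (ih (d := d + 1) hk' (hk' (Nat.lt_succ_self d)) (Fin.snoc xs x)
        (fun j => h.lt_of_lt_of_le (ha j) hi'.le) (hlt hi'.le hx)).2 this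

theorem coe_add (x y : h.cutSubstructure) : ((x + y : h.cutSubstructure) : U) = x + y := by
  refine congrArg (Structure.funMap addSym) (funext fun i => ?_)
  fin_cases i <;> rfl

theorem coe_mul (x y : h.cutSubstructure) : ((x * y : h.cutSubstructure) : U) = x * y := by
  refine congrArg (Structure.funMap mulSym) (funext fun i => ?_)
  fin_cases i <;> rfl

theorem coe_zero : ((0 : h.cutSubstructure) : U) = 0 :=
  congrArg (Structure.funMap zeroSym) (Subsingleton.elim _ _)

theorem coe_one : ((1 : h.cutSubstructure) : U) = 1 :=
  congrArg (Structure.funMap oneSym) (Subsingleton.elim _ _)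

-- The instance is named, because Mathlib's order on subtypes also applies here.
theorem coe_lt (x y : h.cutSubstructure) :
    @LT.lt _ (ltInst h.cutSubstructure) x y ↔ (x : U) < y := by
  refine iff_of_eq (congrArg (Structure.RelMap ltSym) (funext fun i => ?_))
  fin_cases i <;> rfl

theorem isDiscreteOrderedSemiring_cut : IsDiscreteOrderedSemiring h.cutSubstructure := by
  have hU := h.semiring
  constructor <;>
    try simp only [h.coe_lt, Subtype.ext_iff, h.coe_add, h.coe_mul, h.coe_zero, h.coe_one]
  · exact fun x => hU.add_zero x
  · exact fun x y => hU.add_comm x y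
  · exact fun x y z => hU.add_assoc x y z
  · exact fun x => hU.mul_zero x
  · exact fun x => hU.mul_one x
  · exact fun x y => hU.mul_comm x y
  · exact fun x y z => hU.mul_assoc x y z
  · exact fun x y z => hU.mul_add x y z
  · exact fun x => hU.irrefl x
  · exact fun x y z => hU.trans x y z
  · exact fun x y => hU.trichotomy x y
  · exact fun x => hU.zero_or_pos x
  · exact fun x y => hU.lt_succ x y
  · intro x hx
    obtain ⟨y, hy⟩ := hU.exists_pred x fun e => hx (Subtype.ext (e.trans h.coe_zero.symm))
    obtain ⟨i, hi⟩ := x.2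
    exact ⟨⟨y, i, hU.trans _ _ _ (hy ▸ hU.lt_succ_self y) hi⟩, hy⟩
  · exact fun x y z => hU.add_lt_add x y z
  · exact fun x y z => hU.mul_lt_mul x y z

/-- Below a bound `c i` for the parameters and the induction variable, truth in the cut is expressed
by a limited formula, so that limited induction in `U` gives full induction in the cut. -/
theorem models_inductionAxiom_cut {n : ℕ} (φ : arith.Formula (Fin n ⊕ Fin 1)) :
    h.cutSubstructure ⊨ inductionAxiom φ := by
  have hU := h.semiring
  rw [realize_inductionAxiom]
  intro w zero succ x
  obtain ⟨i, hw, hx⟩ : ∃ i, (∀ j, (w j : U) < c i) ∧ (x : U) < c i := by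
    choose f hf using fun j => (w j).2
    obtain ⟨b, hb⟩ := x.2
    refine ⟨max (Finset.univ.sup f) b, fun j => h.lt_of_lt_of_le (hf j) ?_,
      h.lt_of_lt_of_le hb (le_max_right _ _)⟩
    exact (Finset.le_sup (Finset.mem_univ j)).trans (le_max_left _ _)
  let θ : arith.BoundedFormula (Fin n) 1 := BoundedFormula.sub
    (Sum.elim (Sum.elim (fun j => Term.var (Sum.inl j)) fun _ => &0) fun j => Fin.elim0 j) φ
  have hθ : ∀ y : h.cutSubstructure, φ.Realize (Sum.elim w fun _ => y) ↔
      θ.Realize w fun _ => y := by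
    intro y
    rw [BoundedFormula.realize_sub]
    refine iff_of_eq ?_
    rw [Formula.Realize]
    congr 1
    · funext a
      rcases a with j | j <;> rfl
    · exact Subsingleton.elim _ _
  have hk : StrictMono fun e => i + 1 + e := fun e e' he => Nat.add_lt_add_left he _
  let Q : U → Prop := fun y => (boundedTranslation 0 θ).Realize
    (Sum.elim (fun j => (w j : U)) fun e => c (i + 1 + e)) fun _ => y
  have hQ : ∀ y : h.cutSubstructure, (y : U) < c i →
      (φ.Realize (Sum.elim w fun _ => y) ↔ Q y) := fun y hy =>
    (hθ y).trans (h.realize_iff θ hk (by omega) w _ hw fun _ => hy)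
  suffices ∀ y : U, y < c i → Q y from (hQ x hx).2 (this x hx)
  obtain ⟨r, hr⟩ := exists_realize_boundedTranslation_congr θ 0 U
  let σ : (Fin n ⊕ ℕ) ⊕ Fin 1 → arith.Term ((Fin (n + (r + 1)) ⊕ Fin 1) ⊕ Fin 0) :=
    Sum.elim (Sum.elim (fun j => Term.var (Sum.inl (Sum.inl (Fin.castAdd (r + 1) j))))
      fun e => Term.var (Sum.inl (Sum.inl (Fin.natAdd n ⟨min (e + 1) r, by omega⟩))))
      fun _ => Term.var (Sum.inl (Sum.inr 0))
  refine ((isLimited_lt (Term.var (Sum.inl (Sum.inr 0)))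
    (Term.var (Sum.inl (Sum.inl (Fin.natAdd n 0))))).imp
    ((isLimited_boundedTranslation θ 0).sub σ)).induction h.induction
    (Fin.append (fun j => (w j : U)) fun e : Fin (r + 1) => c (i + e)) (P := fun y => y < c i → Q y)
    (fun y => ?_) (fun h₀ => ?_) fun y ih hy => ?_
  · rw [Formula.Realize, BoundedFormula.realize_imp, realize_lt, BoundedFormula.realize_sub]
    refine imp_congr (by simp) ?_
    refine Iff.trans ?_ (hr (fun j => (w j : U)) (fun e => c (i + min (e + 1) r)) _ _ ?_)
    · refine iff_of_eq ?_
      congr 1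
      · funext a
        rcases a with j | e
        · simp [σ]
        · exact Fin.append_right (fun j => (w j : U)) (fun e : Fin (r + 1) => c (i + e)) _
    · intro j _ hj
      congr 1
      omega
  · have := (hQ 0 (h.coe_zero ▸ h₀)).1 zero
    rwa [h.coe_zero] at this
  · have hy' := hU.trans _ _ _ (hU.lt_succ_self y) hy
    have hs := succ ⟨y, i, hy'⟩ ((hQ ⟨y, i, hy'⟩ hy').2 (ih hy'))
    have hc : (((⟨y, i, hy'⟩ : h.cutSubstructure) + 1 : h.cutSubstructure) : U) = y + 1 := by
      rw [h.coe_add, h.coe_one]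
    have := (hQ _ (hc ▸ hy)).1 hs
    rwa [hc] at this

theorem models_peano_cut : h.cutSubstructure ⊨ peano := by
  refine h.isDiscreteOrderedSemiring_cut.models_peanoBasic.union ⟨?_⟩
  rintro _ ⟨n, φ, rfl⟩
  exact h.models_inductionAxiom_cut φ

end IsIndiscernibleModel

end Arith

theorem mainTheorem2 :
    (Consistent Arith.theoryT → Consistent Arith.peano) ∧
    ∀ (U : Type*) [Arith.arith.Structure U] [Arith.arith[[ℕ]].Structure U]
      [(Arith.arith.lhomWithConstants ℕ).IsExpansionOn U], U ⊨ Arith.theoryT →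
      (∀ a b : U, Arith.ltIn U a b → b ∈ Arith.cut U → a ∈ Arith.cut U) ∧
      (∀ a b : U, a ∈ Arith.cut U → b ∈ Arith.cut U →
        Arith.addIn U a b ∈ Arith.cut U ∧ Arith.mulIn U a b ∈ Arith.cut U) ∧
      ∃ I : Arith.arith.Substructure U, (I : Set U) = Arith.cut U ∧
        I ⊨ Arith.peano ∧
        ∀ (s : ℕ) (θ : Arith.arith.Formula (Fin s)) (i : ℕ) (k : ℕ → ℕ) (a : Fin s → I),
          StrictMono k → i < k 0 → (∀ j, Arith.ltIn U (a j : U) (Arith.c U i)) →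
          (θ.Realize a ↔
            Formula.Realize (Arith.boundedTranslation 0 θ)
              (Sum.elim (fun j => (a j : U)) fun d => Arith.c U (k d))) := by
  refine ⟨fun hT => ?_, fun U _ _ _ hU => ?_⟩
  · obtain ⟨U, _, hU⟩ := hT.exists_model
    let _ : Arith.arith.Structure U := (Arith.arith.lhomWithConstants ℕ).reduct U
    have := LHom.isExpansionOn_reduct (Arith.arith.lhomWithConstants ℕ) U
    have h := Arith.isIndiscernibleModel U hU
    have : Nonempty h.cutSubstructure := ⟨⟨_, 1, h.zero_lt⟩⟩
    exact consistent_of_model h.cutSubstructure h.models_peano_cut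
  · have h := Arith.isIndiscernibleModel U hU
    refine ⟨fun a b hab ⟨i, hi⟩ => ⟨i, h.semiring.trans _ _ _ hab hi⟩, fun a b ⟨i, hi⟩ ⟨j, hj⟩ => ?_,
      h.cutSubstructure, rfl, h.models_peano_cut, fun s θ i k a hk hi ha => ?_⟩
    · obtain ⟨k, -, hadd, hmul⟩ := h.exists_bound hi hj
      exact ⟨⟨k, hadd⟩, ⟨k, hmul⟩⟩
    · refine (h.realize_iff θ hk hi a default ha fun j => Fin.elim0 j).trans (iff_of_eq ?_)
      rw [Formula.Realize]
      congr 1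
      exact Subsingleton.elim _ _
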